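/- **Jeffrey–Kirwan residues.** Let $\mathbf Q_*\subset\mathbb R^n$ be a finite set of nonzero vectors and $\phi_*\in\mathbb C^n$. Let $\hat R$ be the ring of all fractions $f/\prod_{Q\in\mathbf Q_*}(Q\cdot(\phi-\phi_*))^{m_Q}$ with $f$ a formal power series in the $\phi_j-\phi_{*j}$ and $m_Q\in\mathbb N$, graded by degree, with part $\hat R[-n]$ of degree $-n$. Let $\mathfrak B(\mathbf Q_*)$ be the set of bases of $\mathbf Q_*$, i.e. of the subsets $\sigma\subseteq\mathbf Q_*$ that form a basis of $\mathbb R^n$. For $\sigma\in\mathfrak B(\mathbf Q_*)$ put $f_\sigma=1/\prod_{Q\in\sigma}Q\cdot(\phi-\phi_*)$ and $\mathrm{Cone}(\sigma)=\{\sum_{Q\in\sigma}a_QQ: a_Q>0\}$; write $\sigma=\{Q_1^\sigma,\dots,Q_n^\sigma\}$ and let $e_1,\dots,e_n$ be the canonical basis of $\mathbb R^n$. Let $S$ be the span of the $f_\sigma$, and $NS$ the span of the fractions $\psi/\prod_{Q\in\kappa}(Q\cdot(\phi-\phi_*))^{n_Q}$ of degree $-n$ with $\psi$ a polynomial and $\kappa\subseteq\mathbf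 Q_*$ containing no basis; then $\hat R[-n]=S\oplus NS$. Call $\mathbf Q_*$ *projective* if some $\delta\in\mathbb R^n$ has $\delta\cdot Q>0$ for all $Q\in\mathbf Q_*$, and call $\eta\in\mathbb R^n$ *generic* for $\mathbf Q_*$ if it lies in no span of $n-1$ elements of $\mathbf Q_*$. For projective $\mathbf Q_*$ and generic $\eta$, $\mathrm{JK\text{-}Res}_{\eta,\phi_*}:\hat R\to\mathbb C$ is the composite of the projection $\hat R\to\hat R[-n]$, the projection $\hat R[-n]\to S$ along $NS$, and the (well-defined) linear functional on $S$ that sends $f_\sigma$ to $|\det(Q_i^\sigma\cdot e_j)|^{-1}$ if $\eta\in\mathrm{Cone}(\sigma)$ and to $0$ otherwise. If $\mathfrak B(\mathbf Q_*)=\emptyset$, then $S=0$ and $\mathrm{JK\text{-}Res}_{\eta,\phi_*}=0$. **Setting.** Let $W\subset O(n)$ be a finite subgroup (for instance the Weyl group of a simple Lie group of rank $n$), acting on $\mathbb R^n$ and on $\mathbb C^n$. Let $\mathcal Z$ be a rational function on $\mathbb C^n$, invariant under $W$, given as a quotient of polynomials whose denominator is a product of positive powers of affine forms $Q_H\cdot\phi+b_H$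 that define finitely many distinct hyperplanes $H$, with one fixed vector $Q_H\in\mathbb R^n\setminus\{0\}$ and one $b_H\in\mathbb C$ for each $H$. For $\phi_*\in\mathbb C^n$ put $\mathbf Q_*(\phi_*)=\{Q_H : \phi_*\in H\}$; expanding at $\phi_*$ makes $\mathcal Z$ an element of $\hat R$ for $\mathbf Q_*(\phi_*)$. Assume that for every $\phi_*$ for which $\mathbf Q_*(\phi_*)$ contains a basis of $\mathbb R^n$: 1. the choice of vectors is compatible with $W$: $\mathbf Q_*(g\cdot\phi_*)=g\cdot\mathbf Q_*(\phi_*)$ for all $g\in W$; 2. $\mathbf Q_*(\phi_*)$ is projective; 3. $\eta\in\mathbb R^n$ is generic for $\mathbf Q_*(\phi_*)$. **Proposition.** There are only finitely many $\phi_*\in\mathbb C^n$ for which $\mathbf Q_*(\phi_*)$ contains a basis, and $\mathrm{JK\text{-}Res}_{\eta,\phi_*}\mathcal Z=0$ for all other $\phi_*$. Moreover $$Z_\eta:=\sum_{\phi_*\in\mathbb C^n}\mathrm{JK\text{-}Res}_{\eta,\phi_*}\mathcal Z=\sum_{[\phi_*]}\frac1{C_{[\phi_*]}}\sum_{\sigma\in\mathfrak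 B(\mathbf Q_*(\phi_*))}\frac{A_{\sigma,\eta}\,c_\sigma(\phi_*)}{|\det(Q_i^\sigma\cdot e_j)|}.$$ Here $[\phi_*]$ runs over the $W$-orbits in $\mathbb C^n$, $\phi_*$ is an arbitrarily chosen representative of each orbit, $C_{[\phi_*]}$ is the order of the stabilizer of $\phi_*$ in $W$, the $c_\sigma(\phi_*)\in\mathbb C$ are any coefficients for which $\sum_\sigma c_\sigma(\phi_*)f_\sigma$ is the image of $\mathcal Z$ under $\hat R\to\hat R[-n]\to S$ at $\phi_*$, and $A_{\sigma,\eta}=\sum_{g\in W}\mathbf 1_{\mathrm{Cone}(g\cdot\sigma)}(\eta)$ with $g\cdot\sigma=\{g\cdot Q: Q\in\sigma\}$. -/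

import Mathlib

open scoped BigOperators

noncomputable section

open Classical in
/-- The set `𝔅(Q_*)` of all bases of `Q_*`: the subsets of `Q_*` that form a basis of `ℝⁿ`. -/
def jkBases {n : ℕ} (Qs : Finset (Fin n → ℝ)) : Finset (Finset (Fin n → ℝ)) :=
  Qs.powerset.filter fun σ =>
    LinearIndependent ℝ (fun Q : σ => (Q : Fin n → ℝ)) ∧
      Submodule.span ℝ (σ : Set (Fin n → ℝ)) = ⊤

/-- `Q_*` is projective: some `δ ∈ ℝⁿ` has positive inner product with every element. -/
def IsProjectiveSet {n : ℕ} (Qs : Finset (Fin n → ℝ)) : Prop :=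
  ∃ δ : Fin n → ℝ, ∀ Q ∈ Qs, 0 < δ ⬝ᵥ Q

/-- `η` is generic with respect to `Q_*`: it lies in no span of `n - 1` elements of `Q_*`. -/
def IsGenericVector {n : ℕ} (Qs : Finset (Fin n → ℝ)) (η : Fin n → ℝ) : Prop :=
  ∀ κ ⊆ Qs, κ.card + 1 = n → η ∉ Submodule.span ℝ (κ : Set (Fin n → ℝ))

/-- The open cone `Cone(σ)` of strictly positive combinations of the elements of `σ`. -/
def openCone {n : ℕ} (σ : Finset (Fin n → ℝ)) : Set (Fin n → ℝ) :=
  {v | ∃ a : (Fin n → ℝ) → ℝ, (∀ Q ∈ σ, 0 < a Q) ∧ v = ∑ Q ∈ σ, a Q • Q}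

/-- `|det (Q_i · e_j)|` for `σ = {Q_1, …, Q_n}`; the enumeration of `σ` that is used only
affects the sign of the determinant. (Value `0` if `σ` does not have `n` elements.) -/
def absDet {n : ℕ} (σ : Finset (Fin n → ℝ)) : ℝ :=
  if h : σ.card = n then
    |Matrix.det (Matrix.of fun i j : Fin n => ((σ.equivFinOfCardEq h).symm i : Fin n → ℝ) j)|
  else 0

/-- The fraction field of the ring of formal power series in the local coordinates
`x_j = φ_j - φ_{*j}` at a point `φ_*`. -/
abbrev LocalField (n : ℕ) : Type := FractionRing (MvPowerSeries (Fin n) ℂ)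

/-- The linear form `Q · x = Q · (φ - φ_*)`. -/
def linForm {n : ℕ} (Q : Fin n → ℝ) : MvPolynomial (Fin n) ℂ :=
  ∑ j, MvPolynomial.C (Q j : ℂ) * MvPolynomial.X j

/-- A polynomial in the local coordinates as an element of the fraction field. -/
def polyToLocal {n : ℕ} (p : MvPolynomial (Fin n) ℂ) : LocalField n :=
  algebraMap (MvPowerSeries (Fin n) ℂ) (LocalField n) (p : MvPowerSeries (Fin n) ℂ)

/-- The product `∏_{Q ∈ κ} (Q · x)^{m_Q}`. -/
def linProd {n : ℕ} (κ : Finset (Fin n → ℝ)) (m : (Fin n → ℝ) → ℕ) : LocalField n :=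
  ∏ Q ∈ κ, polyToLocal (linForm Q) ^ m Q

/-- The basic fraction `f_σ = 1 / ∏_{Q ∈ σ} Q · x`. -/
def basicFraction {n : ℕ} (σ : Finset (Fin n → ℝ)) : LocalField n :=
  1 / ∏ Q ∈ σ, polyToLocal (linForm Q)

/-- The space `S_{Q_*}`: the linear span of the basic fractions of the bases of `Q_*`. -/
def spaceS {n : ℕ} (Qs : Finset (Fin n → ℝ)) : Submodule ℂ (LocalField n) :=
  Submodule.span ℂ {F | ∃ σ ∈ jkBases Qs, F = basicFraction σ}

/-- The space `NS_{Q_*}`: the linear span of the fractions `ψ / ∏_{Q ∈ κ} (Q · x)^{m_Q}` of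
degree `-n`, where `ψ` is a polynomial and `κ ⊆ Q_*` contains no basis of `Q_*`. -/
def spaceNS {n : ℕ} (Qs : Finset (Fin n → ℝ)) : Submodule ℂ (LocalField n) :=
  Submodule.span ℂ {F | ∃ κ ⊆ Qs, (∀ σ ∈ jkBases Qs, ¬ σ ⊆ κ) ∧
    ∃ (m : (Fin n → ℝ) → ℕ) (k : ℕ) (ψ : MvPolynomial (Fin n) ℂ),
      ψ.IsHomogeneous k ∧ k + n = ∑ Q ∈ κ, m Q ∧ F = polyToLocal ψ / linProd κ m}

/-- `F = f / ∏_{Q ∈ Q_*} (Q · x)^{m_Q}` lies in the ring `R̂_{Q_*}` of such fractions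
(`f` a formal power series), and `G` is its homogeneous part of degree `d`: the homogeneous
part of `f` of degree `d + ∑ m_Q`, divided by the same product. -/
def IsDegreePart {n : ℕ} (Qs : Finset (Fin n → ℝ)) (d : ℤ) (F G : LocalField n) : Prop :=
  ∃ (f : MvPowerSeries (Fin n) ℂ) (m : (Fin n → ℝ) → ℕ),
    F = algebraMap _ (LocalField n) f / linProd Qs m ∧
    ((∃ k : ℕ, (k : ℤ) = d + ∑ Q ∈ Qs, (m Q : ℤ) ∧
        G = algebraMap _ (LocalField n) (MvPowerSeries.homogeneousComponent k f) / linProd Qs m) ∨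
      (d + ∑ Q ∈ Qs, (m Q : ℤ) < 0 ∧ G = 0))

open Classical in
/-- The map `R̂_{Q_*} → R̂_{Q_*}[-n] = S_{Q_*} ⊕ NS_{Q_*} → S_{Q_*}`: the projection to the part
of degree `-n`, followed by the projection along `NS_{Q_*}`.
(Value `0` outside `R̂_{Q_*}`.) -/
def simplePart {n : ℕ} (Qs : Finset (Fin n → ℝ)) (F : LocalField n) : spaceS Qs :=
  if h : ∃ s : spaceS Qs, ∃ G, IsDegreePart Qs (-(n : ℤ)) F G ∧ G - (s : LocalField n) ∈ spaceNS Qs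
  then h.choose else 0

/-- `J` is a linear functional on `S_{Q_*}` whose value at each basic fraction `f_σ` is
`|det (Q_i · e_j)|⁻¹` if `η ∈ Cone(σ)`, and `0` otherwise. -/
def IsJKFunctional {n : ℕ} (Qs : Finset (Fin n → ℝ)) (η : Fin n → ℝ)
    (J : spaceS Qs →ₗ[ℂ] ℂ) : Prop :=
  ∀ (σ : Finset (Fin n → ℝ)) (hσ : σ ∈ jkBases Qs),
    (η ∈ openCone σ →
      J ⟨basicFraction σ, Submodule.subset_span ⟨σ, hσ, rfl⟩⟩ = ((absDet σ)⁻¹ : ℝ)) ∧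
    (η ∉ openCone σ → J ⟨basicFraction σ, Submodule.subset_span ⟨σ, hσ, rfl⟩⟩ = 0)

open Classical in
/-- The Jeffrey–Kirwan functional on `S_{Q_*}`: the linear functional with the prescribed values
at the basic fractions. It is unique, since these span, and it exists for projective `Q_*` and
generic `η`. (Value `0` if there is none.) -/
def jkFunctional {n : ℕ} (Qs : Finset (Fin n → ℝ)) (η : Fin n → ℝ) : spaceS Qs →ₗ[ℂ] ℂ :=
  if h : ∃ J, IsJKFunctional Qs η J then h.choose else 0

/-- The Jeffrey–Kirwan residue on `R̂_{Q_*}`, as the composite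
`R̂_{Q_*} → R̂_{Q_*}[-n] → S_{Q_*} → ℂ`. -/
def localJKRes {n : ℕ} (Qs : Finset (Fin n → ℝ)) (η : Fin n → ℝ) (F : LocalField n) : ℂ :=
  jkFunctional Qs η (simplePart Qs F)

/-- The affine form `Q · φ + b` given by a pair `h = (Q, b)`, at a point `φ ∈ ℂⁿ`. -/
def affineValue {n : ℕ} (h : (Fin n → ℝ) × ℂ) (φ : Fin n → ℂ) : ℂ :=
  ∑ j, (h.1 j : ℂ) * φ j + h.2

/-- A rational function on `ℂⁿ` whose denominator is completely factorized into distinct affine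
hyperplanes `{Q · φ + b = 0}` with `Q ∈ ℝⁿ` (each to some positive power), together with the
choice of one coefficient vector `Q` for each of these hyperplanes. -/
structure FactorizedFraction (n : ℕ) where
  num : MvPolynomial (Fin n) ℂ
  factors : Finset ((Fin n → ℝ) × ℂ)
  mult : (Fin n → ℝ) × ℂ → ℕ
  mult_pos : ∀ h ∈ factors, 0 < mult h
  vec_ne_zero : ∀ h ∈ factors, h.1 ≠ 0
  distinct : ∀ h ∈ factors, ∀ h' ∈ factors,
    {φ | affineValue h φ = 0} = {φ | affineValue h' φ = 0} → h = h'

namespace FactorizedFraction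

variable {n : ℕ} (Z : FactorizedFraction n)

/-- The value of the rational function at a point. -/
def eval (φ : Fin n → ℂ) : ℂ :=
  MvPolynomial.eval φ Z.num / ∏ h ∈ Z.factors, affineValue h φ ^ Z.mult h

/-- The point `φ` is on none of the hyperplanes of the denominator. -/
def IsRegularAt (φ : Fin n → ℂ) : Prop :=
  ∀ h ∈ Z.factors, affineValue h φ ≠ 0

open Classical in
/-- `Q_*(φ_*)`: the coefficient vectors of the hyperplanes that contain `φ_*`. -/
def Qstar (φ : Fin n → ℂ) : Finset (Fin n → ℝ) :=
  (Z.factors.filter fun h => affineValue h φ = 0).image Prod.fst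

/-- The points `φ_*` for which `Q_*(φ_*)` contains a basis of `ℝⁿ`. -/
def IsVertex (φ : Fin n → ℂ) : Prop :=
  (jkBases (Z.Qstar φ)).Nonempty

/-- The expansion of the rational function at `φ_*`: the substitution `φ = φ_* + x` in numerator
and denominator, in the fraction field of the ring of formal power series in `x`. -/
def expand (φ : Fin n → ℂ) : LocalField n :=
  polyToLocal (MvPolynomial.bind₁ (fun j => MvPolynomial.X j + MvPolynomial.C (φ j)) Z.num) /
    ∏ h ∈ Z.factors, polyToLocal (linForm h.1 + MvPolynomial.C (affineValue h φ)) ^ Z.mult h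

/-- `JK-Res_{η, φ_*} 𝒵`. -/
def jkRes (η : Fin n → ℝ) (φ : Fin n → ℂ) : ℂ :=
  localJKRes (Z.Qstar φ) η (Z.expand φ)

/-- `Z_η = ∑_{φ_*} JK-Res_{η, φ_*} 𝒵`. -/
def totalJKRes (η : Fin n → ℝ) : ℂ :=
  ∑ᶠ φ : Fin n → ℂ, Z.jkRes η φ

end FactorizedFraction

/-- The action of `O(n)` on `ℂⁿ`, the complexification of its action on `ℝⁿ`. -/
instance orthogonalSMulComplex {n : ℕ} :
    SMul (Matrix.orthogonalGroup (Fin n) ℝ) (Fin n → ℂ) where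
  smul g φ := (g.1.map Complex.ofReal).mulVec φ

instance orthogonalActionComplex {n : ℕ} :
    MulAction (Matrix.orthogonalGroup (Fin n) ℝ) (Fin n → ℂ) where
  one_smul φ := by
    change ((1 : Matrix (Fin n) (Fin n) ℝ).map Complex.ofReal).mulVec φ = φ
    rw [Matrix.map_one _ Complex.ofReal_zero Complex.ofReal_one, Matrix.one_mulVec]
  mul_smul g h φ := by
    change ((g.1 * h.1).map Complex.ofRealHom).mulVec φ =
      (g.1.map Complex.ofRealHom).mulVec ((h.1.map Complex.ofRealHom).mulVec φ)
    rw [Matrix.map_mul, Matrix.mulVec_mulVec]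

instance subgroupActionComplex {n : ℕ} (W : Subgroup (Matrix.orthogonalGroup (Fin n) ℝ)) :
    MulAction W (Fin n → ℂ) :=
  inferInstance

instance subgroupSMulComplex {n : ℕ} (W : Subgroup (Matrix.orthogonalGroup (Fin n) ℝ)) :
    SMul W (Fin n → ℂ) :=
  SemigroupAction.toSMul

open Classical in
/-- `g · σ = {g · Q | Q ∈ σ}` for `g ∈ O(n)` and a finite set `σ ⊆ ℝⁿ`. -/
def rotateSet {n : ℕ} (g : Matrix.orthogonalGroup (Fin n) ℝ) (σ : Finset (Fin n → ℝ)) :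
    Finset (Fin n → ℝ) :=
  σ.image fun Q => g.1.mulVec Q

/-- `A_{σ,η} = ∑_{g ∈ W} 1_{Cone(g · σ)}(η)`. -/
def coneCount {n : ℕ} (W : Subgroup (Matrix.orthogonalGroup (Fin n) ℝ)) [Fintype W]
    (σ : Finset (Fin n → ℝ)) (η : Fin n → ℝ) : ℕ :=
  ∑ g : W, (openCone (rotateSet g.1 σ)).indicator (fun _ => 1) η

/-- `𝒵` is invariant under `W` as a rational function. -/
def FactorizedFraction.IsSymmetric {n : ℕ} (Z : FactorizedFraction n)
    (W : Subgroup (Matrix.orthogonalGroup (Fin n) ℝ)) : Prop :=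
  ∀ g ∈ W, ∀ φ : Fin n → ℂ, Z.IsRegularAt φ → Z.IsRegularAt (g • φ) → Z.eval (g • φ) = Z.eval φ

/-- The choice of coefficient vectors is compatible with `W`: the vectors at `g · φ_*` are the
images under `g` of the vectors at `φ_*`. -/
def FactorizedFraction.IsCompatible {n : ℕ} (Z : FactorizedFraction n)
    (W : Subgroup (Matrix.orthogonalGroup (Fin n) ℝ)) : Prop :=
  ∀ g ∈ W, ∀ φ : Fin n → ℂ, Z.IsVertex φ → Z.Qstar (g • φ) = rotateSet g (Z.Qstar φ)

end

/-!
The local statement behind the formula is that a relation between basic fractions modulo `NS`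
is a relation between indicator functions of cones. For a basis `σ`, the fraction `f_σ` is, up to
the factor `|det σ|⁻¹`, the Laplace transform of the indicator function of `Cone(σ)`
(`laplace_openCone`). When `Q_*` is projective, with `δ · Q > 0` for all `Q ∈ Q_*`, all these
transforms converge at the points `δ + i t`, where they become Fourier transforms of integrable
functions. Suppose that `∑ c_σ f_σ` lies in `NS`. The denominator of each fraction that spans `NS`
is invariant under translations in some direction `u ≠ 0`, because its linear forms do not span
`ℝⁿ`; hence the fraction is polynomial in this direction and is killed by a power of a difference
operator (`isAnnihilated_div`). On the Fourier side difference operators are multiplications by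
exponential sums that vanish only on a null set, so injectivity of the Fourier transform gives
`∑ c_σ |det σ|⁻¹ 1_{Cone(σ)} = 0` almost everywhere (`combination_mem_spaceNS`).

Two things follow. First, `S ∩ NS = 0`, so the component in `S` of an element of `R̂` is well
defined (`simplePart_eq`). Second, near a generic `η` the indicator functions are constant, so the
relation holds at `η` itself, which says that the prescribed values of the Jeffrey–Kirwan
functional are compatible with all relations between the `f_σ` (`exists_isJKFunctional`).

For the global formula, `g ∈ W` acts on the fraction field of formal power series by the
substitution `x ↦ g⁻¹ x`. It maps the expansion of `𝒵` at `φ` to the one at `g φ`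
(`FactorizedFraction.expand_smul`) and respects degrees, `S` and `NS`, so by uniqueness it commutes
with the projection to `S` (`simplePart_localSubst`). The residue at `g φ` is therefore
`∑ c_σ |det σ|⁻¹ 1_{Cone(g σ)}(η)` with the coefficients `c_σ` at `φ`
(`FactorizedFraction.jkRes_smul`), and summation over an orbit by the orbit–stabilizer theorem
yields the formula.
-/

noncomputable section

open MeasureTheory

/-! ### Injectivity of the Fourier transform -/

theorem integrable_mul_exp_neg_I_dotProduct {n : ℕ} {k : (Fin n → ℝ) → ℂ} (hk : Integrable k)
    (t : Fin n → ℝ) :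
    Integrable fun y => k y * Complex.exp (-(Complex.I * ((t ⬝ᵥ y : ℝ) : ℂ))) := by
  refine hk.mul_bdd (c := 1) ?_ (.of_forall fun y => ?_)
  · refine Continuous.aestronglyMeasurable ?_
    simp only [dotProduct]
    fun_prop
  · rw [← mul_neg, ← Complex.ofReal_neg, mul_comm, Complex.norm_exp_ofReal_mul_I]

/-- The real case of the injectivity of the Fourier transform on integrable functions: the finite
measures with the positive and the negative part of `f` as densities have the same characteristic
function. -/
theorem ae_eq_zero_of_fourier_eq_zero_real {n : ℕ} {f : (Fin n → ℝ) → ℝ} (hf : Integrable f)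
    (h : ∀ t : Fin n → ℝ, ∫ y, (f y : ℂ) * Complex.exp (-(Complex.I * ((t ⬝ᵥ y : ℝ) : ℂ))) = 0) :
    f =ᵐ[volume] 0 := by
  have hm : AEMeasurable f volume := hf.1.aemeasurable
  have hmn : AEMeasurable (fun y => -f y) volume := hm.neg
  have hp : ∫⁻ y, ENNReal.ofReal (f y) ≠ ⊤ := hf.lintegral_lt_top.ne
  have hn : ∫⁻ y, ENNReal.ofReal (-f y) ≠ ⊤ := hf.neg.lintegral_lt_top.ne
  have key : volume.withDensity (fun y => ENNReal.ofReal (f y)) =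
      volume.withDensity (fun y => ENNReal.ofReal (-f y)) := by
    have : IsFiniteMeasure (volume.withDensity (fun y => ENNReal.ofReal (f y))) :=
      isFiniteMeasure_withDensity hp
    have : IsFiniteMeasure (volume.withDensity (fun y => ENNReal.ofReal (-f y))) :=
      isFiniteMeasure_withDensity hn
    apply Measure.ext_of_charFunDual
    ext T
    set t : Fin n → ℝ := fun j => -T (Pi.single j 1) with ht
    have hT : ∀ y, T y = -(t ⬝ᵥ y) := by
      intro y
      conv_lhs => rw [pi_eq_sum_univ' y]
      simp [ht, dotProduct, map_sum, mul_comm]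
    rw [charFunDual_apply, charFunDual_apply,
      integral_withDensity_eq_integral_toReal_smul₀ hm.ennreal_ofReal (by simp),
      integral_withDensity_eq_integral_toReal_smul₀ hmn.ennreal_ofReal (by simp),
      ← sub_eq_zero]
    have hb : ∀ {k : (Fin n → ℝ) → ℝ}, Integrable k →
        Integrable fun y => k y • Complex.exp (T y * Complex.I) := by
      intro k hk
      have := (hk.ofReal (𝕜 := ℂ)).mul_bdd (c := 1)
        (g := fun y => Complex.exp (T y * Complex.I)) (by fun_prop)
        (.of_forall fun y => by rw [Complex.norm_exp_ofReal_mul_I])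
      simpa [Complex.real_smul] using this
    rw [← integral_sub]
    · rw [← h t]
      congr 1
      ext y
      rw [hT y, ← sub_smul, ENNReal.toReal_ofReal', ENNReal.toReal_ofReal',
        max_zero_sub_eq_self, Complex.real_smul]
      push_cast
      ring_nf
    · simpa [ENNReal.toReal_ofReal'] using hb hf.pos_part
    · simpa [ENNReal.toReal_ofReal'] using hb hf.neg_part
  rw [withDensity_eq_iff hm.ennreal_ofReal hmn.ennreal_ofReal hp] at key
  filter_upwards [key] with y hy
  have h1 := congrArg ENNReal.toReal hy
  rw [ENNReal.toReal_ofReal', ENNReal.toReal_ofReal'] at h1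
  have := max_zero_sub_eq_self (f y)
  simp only [Pi.zero_apply]
  linarith

/-- Injectivity of the Fourier transform on integrable functions. -/
theorem ae_eq_zero_of_fourier_eq_zero {n : ℕ} {f : (Fin n → ℝ) → ℂ} (hf : Integrable f)
    (h : ∀ t : Fin n → ℝ, ∫ y, f y * Complex.exp (-(Complex.I * ((t ⬝ᵥ y : ℝ) : ℂ))) = 0) :
    f =ᵐ[volume] 0 := by
  -- the Fourier transform of the complex conjugate vanishes as well
  have h' : ∀ t : Fin n → ℝ,
      ∫ y, starRingEnd ℂ (f y) * Complex.exp (-(Complex.I * ((t ⬝ᵥ y : ℝ) : ℂ))) = 0 := by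
    intro t
    have := congrArg (starRingEnd ℂ) (h (-t))
    rw [← integral_conj, map_zero] at this
    rw [← this]
    congr 1
    ext y
    rw [map_mul, ← Complex.exp_conj]
    simp
  have hfc : Integrable fun y => starRingEnd ℂ (f y) :=
    (integrable_norm_iff (by exact Complex.continuous_conj.comp_aestronglyMeasurable hf.1)).1
      (by simpa using hf.norm)
  have hre : (fun y => (f y).re) =ᵐ[volume] 0 := by
    refine ae_eq_zero_of_fourier_eq_zero_real hf.re fun t => ?_
    have := integral_add (integrable_mul_exp_neg_I_dotProduct hf t)
      (integrable_mul_exp_neg_I_dotProduct hfc t)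
    rw [h, h', add_zero] at this
    rw [← mul_right_inj' (two_ne_zero (α := ℂ)), mul_zero, ← this, ← integral_const_mul]
    congr 1
    ext y
    rw [← add_mul, Complex.add_conj]
    push_cast
    ring
  have him : (fun y => (f y).im) =ᵐ[volume] 0 := by
    refine ae_eq_zero_of_fourier_eq_zero_real hf.im fun t => ?_
    have := integral_sub (integrable_mul_exp_neg_I_dotProduct hf t)
      (integrable_mul_exp_neg_I_dotProduct hfc t)
    rw [h, h', sub_zero] at this
    rw [← mul_right_inj' (mul_ne_zero (two_ne_zero (α := ℂ)) Complex.I_ne_zero), mul_zero, ← this,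
      ← integral_const_mul]
    congr 1
    ext y
    rw [← sub_mul, Complex.sub_conj]
    push_cast
    ring
  filter_upwards [hre, him] with y h1 h2
  exact Complex.ext h1 h2

/-! ### Laplace transforms of simplicial cones -/

theorem absDet_image {n : ℕ} {q : Fin n → Fin n → ℝ} (hq : Function.Injective q) :
    absDet (Finset.univ.image q) = |(Matrix.of q).det| := by
  classical
  have hc : (Finset.univ.image q).card = n := by
    rw [Finset.card_image_of_injective _ hq, Finset.card_univ, Fintype.card_fin]
  rw [absDet, dif_pos hc]
  set e := (Finset.univ.image q).equivFinOfCardEq hc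
  -- two enumerations of the same set differ by a permutation, which only affects the sign
  have hmem : ∀ i, q i ∈ Finset.univ.image q := fun i =>
    Finset.mem_image_of_mem q (Finset.mem_univ i)
  let τ : Fin n → Fin n := fun i => e ⟨q i, hmem i⟩
  have hτ : Function.Injective τ := fun i j hij => hq (by simpa using e.injective hij)
  let π : Equiv.Perm (Fin n) := Equiv.ofBijective τ (Finite.injective_iff_bijective.1 hτ)
  have : (Matrix.of q) =
      (Matrix.of fun i j : Fin n => ((e.symm i : Fin n → ℝ)) j).submatrix π id := by
    ext i j
    simp [π, τ]
  rw [this, Matrix.det_permute, abs_mul]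
  rcases Int.units_eq_one_or (Equiv.Perm.sign π) with h | h <;> simp [h]

theorem exists_enumeration {n : ℕ} {Qs σ : Finset (Fin n → ℝ)} (hσ : σ ∈ jkBases Qs) :
    ∃ q : Fin n → Fin n → ℝ, LinearIndependent ℝ q ∧ σ = Finset.univ.image q := by
  classical
  obtain ⟨-, hli, hsp⟩ := Finset.mem_filter.1 hσ
  have hc : σ.card = n := by
    have h2 := Module.finrank_eq_card_basis (Module.Basis.mk hli (by simp [hsp]))
    simpa using h2.symm
  refine ⟨fun i => ((σ.equivFinOfCardEq hc).symm i : Fin n → ℝ),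
    hli.comp _ (σ.equivFinOfCardEq hc).symm.injective, ?_⟩
  ext Q
  simp only [Finset.mem_image, Finset.mem_univ, true_and]
  exact ⟨fun h => ⟨σ.equivFinOfCardEq hc ⟨Q, h⟩, by simp⟩, by rintro ⟨i, rfl⟩; simp⟩

theorem det_ne_zero_of_linearIndependent {n : ℕ} {q : Fin n → Fin n → ℝ}
    (hq : LinearIndependent ℝ q) : (Matrix.of q).det ≠ 0 := by
  have : IsUnit (Matrix.of q) := Matrix.linearIndependent_rows_iff_isUnit.1 hq
  exact ((Matrix.isUnit_iff_isUnit_det _).1 this).ne_zero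

/-- The simplicial cone on the vectors `q i` is the image of the open positive orthant under the
linear map whose matrix has the columns `q i`. -/
theorem openCone_image {n : ℕ} {q : Fin n → Fin n → ℝ} (hq : Function.Injective q) :
    openCone (Finset.univ.image q) =
      (Matrix.toLin' (Matrix.of q).transpose).toContinuousLinearMap ''
        Set.univ.pi fun _ => Set.Ioi 0 := by
  classical
  have hA : ∀ a : Fin n → ℝ, Matrix.toLin' (Matrix.of q).transpose a = ∑ i, a i • q i := by
    intro a
    ext j
    simp [Matrix.mulVec, dotProduct, mul_comm]
  ext v
  constructor
  · rintro ⟨a, ha, rfl⟩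
    refine ⟨fun i => a (q i), fun i _ => ha _ (by simp), ?_⟩
    rw [Finset.sum_image fun _ _ _ _ h => hq h]
    exact hA _
  · rintro ⟨a, ha, rfl⟩
    refine ⟨Function.extend q a 1, fun Q hQ => ?_, ?_⟩
    · obtain ⟨i, -, rfl⟩ := Finset.mem_image.1 hQ
      rw [hq.extend_apply]
      exact ha i trivial
    · rw [Finset.sum_image fun _ _ _ _ h => hq h]
      simp only [hq.extend_apply]
      exact hA a

/-- The point `δ + i t` of `ℂⁿ` with real part `δ` and imaginary part `t`. -/
def complexPoint {n : ℕ} (δ t : Fin n → ℝ) : Fin n → ℂ := fun j => (δ j : ℂ) + Complex.I * (t j : ℂ)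

theorem eval_linForm {n : ℕ} (Q : Fin n → ℝ) (z : Fin n → ℂ) :
    MvPolynomial.eval z (linForm Q) = ∑ j, (Q j : ℂ) * z j := by
  simp [linForm]

theorem eval_linForm_complexPoint {n : ℕ} (Q δ t : Fin n → ℝ) :
    MvPolynomial.eval (complexPoint δ t) (linForm Q) =
      ((δ ⬝ᵥ Q : ℝ) : ℂ) + Complex.I * ((t ⬝ᵥ Q : ℝ) : ℂ) := by
  simp only [eval_linForm, complexPoint, dotProduct]
  push_cast
  rw [Finset.mul_sum, ← Finset.sum_add_distrib]
  exact Finset.sum_congr rfl fun j _ => by ring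

theorem eval_linForm_complexPoint_ne_zero {n : ℕ} {Q δ : Fin n → ℝ} (h : 0 < δ ⬝ᵥ Q)
    (t : Fin n → ℝ) : MvPolynomial.eval (complexPoint δ t) (linForm Q) ≠ 0 := by
  intro h0
  rw [eval_linForm_complexPoint] at h0
  have := congrArg Complex.re h0
  simp at this
  exact h.ne' this

/-- The exponential `e^{-δ·y}` on the open cone on `σ`, extended by zero. -/
def coneExp {n : ℕ} (σ : Finset (Fin n → ℝ)) (δ : Fin n → ℝ) : (Fin n → ℝ) → ℂ :=
  (openCone σ).indicator fun y => Complex.exp (-((δ ⬝ᵥ y : ℝ) : ℂ))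

/-- The Laplace transform of a simplicial cone at the point `δ + i t`. It is computed in the
coordinates of the cone, where the integral is a product of one-dimensional ones. -/
theorem laplace_openCone {n : ℕ} {q : Fin n → Fin n → ℝ} (hq : LinearIndependent ℝ q)
    {δ : Fin n → ℝ} (hδ : ∀ i, 0 < δ ⬝ᵥ q i) (t : Fin n → ℝ) :
    Integrable (fun y => coneExp (Finset.univ.image q) δ y *
      Complex.exp (-(Complex.I * ((t ⬝ᵥ y : ℝ) : ℂ)))) ∧
    ∫ y, coneExp (Finset.univ.image q) δ y * Complex.exp (-(Complex.I * ((t ⬝ᵥ y : ℝ) : ℂ))) =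
      (absDet (Finset.univ.image q) : ℂ) *
        ∏ i, (MvPolynomial.eval (complexPoint δ t) (linForm (q i)))⁻¹ := by
  classical
  set A := (Matrix.toLin' (Matrix.of q).transpose).toContinuousLinearMap with hAdef
  set s : Set (Fin n → ℝ) := Set.univ.pi fun _ => Set.Ioi 0 with hs
  have hsm : MeasurableSet s := MeasurableSet.univ_pi fun _ => measurableSet_Ioi
  have hA : ∀ a : Fin n → ℝ, A a = ∑ i, a i • q i := by
    intro a
    ext j
    simp [A, Matrix.mulVec, dotProduct, mul_comm]
  have hdet : A.det = (Matrix.of q).det := by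
    simp [A, ContinuousLinearMap.det, LinearMap.det_toLin']
  have hinj : Set.InjOn A s := by
    refine Function.Injective.injOn ?_
    rw [injective_iff_map_eq_zero]
    intro a ha
    rw [hA] at ha
    exact funext fun i => Fintype.linearIndependent_iff.1 hq a ha i
  have hder : ∀ x ∈ s, HasFDerivWithinAt A A s x := fun x _ => A.hasFDerivWithinAt
  set G : (Fin n → ℝ) → ℂ := fun y => Complex.exp (-((δ ⬝ᵥ y : ℝ) : ℂ)) *
    Complex.exp (-(Complex.I * ((t ⬝ᵥ y : ℝ) : ℂ))) with hG
  set w : Fin n → ℂ := fun i => -MvPolynomial.eval (complexPoint δ t) (linForm (q i)) with hw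
  have hwre : ∀ i, (w i).re < 0 := by
    intro i
    simp only [hw, eval_linForm_complexPoint]
    simpa using hδ i
  have hGA : ∀ a, G (A a) = ∏ i, Complex.exp (w i * a i) := by
    intro a
    simp only [hG]
    rw [← Complex.exp_add, ← Complex.exp_sum]
    congr 1
    rw [hA, dotProduct_sum, dotProduct_sum]
    simp only [hw, eval_linForm_complexPoint, dotProduct_smul, smul_eq_mul]
    push_cast
    rw [Finset.mul_sum, ← Finset.sum_neg_distrib, ← Finset.sum_neg_distrib,
      ← Finset.sum_add_distrib]
    exact Finset.sum_congr rfl fun i _ => by ring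
  have hcone : openCone (Finset.univ.image q) = A '' s := openCone_image hq.injective
  have himg : MeasurableSet (A '' s) :=
    measurable_image_of_fderivWithin hsm hder hinj
  have hfun : (fun y => coneExp (Finset.univ.image q) δ y *
      Complex.exp (-(Complex.I * ((t ⬝ᵥ y : ℝ) : ℂ)))) = (A '' s).indicator G := by
    ext y
    rw [coneExp, hcone]
    by_cases hy : y ∈ A '' s <;> simp [hy, hG]
  have hres : (volume.restrict s : Measure (Fin n → ℝ)) =
      Measure.pi fun _ => (volume : Measure ℝ).restrict (Set.Ioi 0) := by
    rw [hs, volume_pi, Measure.restrict_pi_pi]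
  rw [hfun, integrable_indicator_iff himg, integral_indicator himg,
    integrableOn_image_iff_integrableOn_abs_det_fderiv_smul volume hsm hder hinj,
    integral_image_eq_integral_abs_det_fderiv_smul volume hsm hder hinj, hdet,
    absDet_image hq.injective]
  simp only [hGA]
  constructor
  · refine Integrable.smul _ ?_
    rw [hres]
    exact Integrable.fintype_prod (f := fun i (x : ℝ) => Complex.exp (w i * x))
      fun i => integrableOn_exp_mul_complex_Ioi (hwre i) 0
  · rw [integral_smul, hres,
      integral_fintype_prod_eq_prod (fun i (x : ℝ) => Complex.exp (w i * x)), Complex.real_smul]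
    congr 1
    refine Finset.prod_congr rfl fun i _ => ?_
    rw [integral_exp_mul_complex_Ioi (hwre i)]
    simp [hw, neg_div]

/-! ### Relations between basic fractions modulo `NS` -/

/-- `polyToLocal` as a homomorphism of `ℂ`-algebras. -/
def polyToLocalHom (n : ℕ) : MvPolynomial (Fin n) ℂ →ₐ[ℂ] LocalField n :=
  (IsScalarTower.toAlgHom ℂ (MvPowerSeries (Fin n) ℂ) (LocalField n)).comp
    (MvPolynomial.coeToMvPowerSeries.algHom ℂ)

theorem polyToLocal_eq {n : ℕ} (p : MvPolynomial (Fin n) ℂ) :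
    polyToLocal p = polyToLocalHom n p := by
  simp [polyToLocal, polyToLocalHom, MvPolynomial.coeToMvPowerSeries.algHom_apply]

theorem polyToLocalHom_injective (n : ℕ) : Function.Injective (polyToLocalHom n) := by
  intro p q h
  rw [← polyToLocal_eq, ← polyToLocal_eq] at h
  exact MvPolynomial.coe_injective _ _ (IsFractionRing.injective (MvPowerSeries (Fin n) ℂ) _ h)

/-- The element `F` is a quotient of polynomials without poles at the points `z t`, and its value
at `z t` is `a t`. -/
def HasEval {n : ℕ} {ι : Type*} (z : ι → Fin n → ℂ) (F : LocalField n) (a : ι → ℂ) : Prop :=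
  ∃ P D : MvPolynomial (Fin n) ℂ, (∀ t, MvPolynomial.eval (z t) D ≠ 0) ∧
    F * polyToLocalHom n D = polyToLocalHom n P ∧
    ∀ t, a t * MvPolynomial.eval (z t) D = MvPolynomial.eval (z t) P

namespace HasEval

variable {n : ℕ} {ι : Type*} {z : ι → Fin n → ℂ} {F G : LocalField n} {a b : ι → ℂ}

theorem zero : HasEval z 0 0 := ⟨0, 1, by simp, by simp, by simp⟩

theorem add (hF : HasEval z F a) (hG : HasEval z G b) : HasEval z (F + G) (a + b) := by
  obtain ⟨P, D, hD, h, h'⟩ := hF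
  obtain ⟨P', D', hD', k, k'⟩ := hG
  refine ⟨P * D' + P' * D, D * D', fun t => ?_, ?_, fun t => ?_⟩
  · rw [map_mul]
    exact mul_ne_zero (hD t) (hD' t)
  · rw [map_add, map_mul, map_mul, map_mul, ← h, ← k]
    ring
  · rw [map_add, map_mul, map_mul, map_mul, ← h', ← k', Pi.add_apply]
    ring

theorem smul (c : ℂ) (hF : HasEval z F a) : HasEval z (c • F) (c • a) := by
  obtain ⟨P, D, hD, h, h'⟩ := hF
  refine ⟨c • P, D, hD, ?_, fun t => ?_⟩
  · rw [map_smul, ← h, smul_mul_assoc]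
  · rw [MvPolynomial.smul_eval, ← h', Pi.smul_apply, smul_eq_mul, mul_assoc]

theorem sum {κ : Type*} {s : Finset κ} {F : κ → LocalField n} {a : κ → ι → ℂ}
    (h : ∀ k ∈ s, HasEval z (F k) (a k)) : HasEval z (∑ k ∈ s, F k) (∑ k ∈ s, a k) := by
  classical
  induction s using Finset.induction_on with
  | empty => simpa using zero
  | insert k s hk ih =>
    rw [Finset.sum_insert hk, Finset.sum_insert hk]
    exact (h k (by simp)).add (ih fun j hj => h j (by simp [hj]))

theorem unique (hF : HasEval z F a) (hG : HasEval z F b) : a = b := by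
  obtain ⟨P, D, hD, h, h'⟩ := hF
  obtain ⟨P', D', hD', k, k'⟩ := hG
  have hP : P * D' = P' * D := by
    apply polyToLocalHom_injective n
    rw [map_mul, map_mul, ← h, ← k]
    ring
  ext t
  apply mul_right_cancel₀ (mul_ne_zero (hD t) (hD' t))
  have := congrArg (MvPolynomial.eval (z t)) hP
  rw [map_mul, map_mul, ← h', ← k'] at this
  rw [← mul_assoc, this]
  ring

/-- Division by a product of powers of linear forms that do not vanish at the points `z t`. -/
theorem div_linProd [Nonempty ι] (ψ : MvPolynomial (Fin n) ℂ) {κ : Finset (Fin n → ℝ)}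
    (hκ : ∀ Q ∈ κ, ∀ t, MvPolynomial.eval (z t) (linForm Q) ≠ 0) (m : (Fin n → ℝ) → ℕ) :
    HasEval z (polyToLocal ψ / linProd κ m) fun t =>
      MvPolynomial.eval (z t) ψ / ∏ Q ∈ κ, MvPolynomial.eval (z t) (linForm Q) ^ m Q := by
  obtain ⟨t₀⟩ := ‹Nonempty ι›
  have hD : ∀ t, MvPolynomial.eval (z t) (∏ Q ∈ κ, linForm Q ^ m Q) =
      ∏ Q ∈ κ, MvPolynomial.eval (z t) (linForm Q) ^ m Q := fun t => by simp
  have hne : ∀ t, ∏ Q ∈ κ, MvPolynomial.eval (z t) (linForm Q) ^ m Q ≠ 0 := fun t =>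
    Finset.prod_ne_zero_iff.2 fun Q hQ => pow_ne_zero _ (hκ Q hQ t)
  refine ⟨ψ, ∏ Q ∈ κ, linForm Q ^ m Q, fun t => by rw [hD]; exact hne t, ?_, fun t => ?_⟩
  · have : polyToLocalHom n (∏ Q ∈ κ, linForm Q ^ m Q) = linProd κ m := by
      simp [linProd, polyToLocal_eq]
    rw [this, polyToLocal_eq, div_mul_cancel₀]
    rw [← this]
    intro h
    have := polyToLocalHom_injective n (h.trans (map_zero _).symm)
    exact hne t₀ (by rw [← hD, this, map_zero])
  · rw [hD, div_mul_cancel₀ _ (hne t)]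

theorem basicFraction {σ : Finset (Fin n → ℝ)} [Nonempty ι]
    (hσ : ∀ Q ∈ σ, ∀ t, MvPolynomial.eval (z t) (linForm Q) ≠ 0) :
    HasEval z (basicFraction σ) fun t => ∏ Q ∈ σ, (MvPolynomial.eval (z t) (linForm Q))⁻¹ := by
  have := div_linProd (z := z) 1 hσ 1
  simpa [_root_.basicFraction, linProd, polyToLocal_eq] using this

end HasEval

/-- A rational function is determined by its values at the points with fixed real part. -/
theorem HasEval.eq_zero {n : ℕ} {δ : Fin n → ℝ} {F : LocalField n}
    (h : HasEval (complexPoint δ) F 0) : F = 0 := by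
  obtain ⟨P, D, hD, hF, hP⟩ := h
  have hP0 : P = 0 := by
    refine MvPolynomial.funext_set (fun j => Set.range fun s : ℝ => (δ j : ℂ) + Complex.I * s)
      (fun j => Set.infinite_range_of_injective fun s s' hs => ?_) fun x hx => ?_
    · simpa using hs
    · choose t ht using fun j => hx j trivial
      have : x = complexPoint δ t := funext fun j => (ht j).symm
      rw [this, ← hP t]
      simp
  have hD0 : polyToLocalHom n D ≠ 0 := by
    intro h0
    refine hD 0 ?_
    rw [polyToLocalHom_injective n (h0.trans (map_zero _).symm), map_zero]
  rw [hP0, map_zero] at hF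
  exact (mul_eq_zero.1 hF).resolve_right hD0

/-- The value at `y` of the exponential sum `∑ u, E u e^{-i u·y}`. -/
def expSum {n : ℕ} (y : Fin n → ℝ) : AddMonoidAlgebra ℂ (Fin n → ℝ) →ₐ[ℂ] ℂ :=
  AddMonoidAlgebra.lift ℂ ℂ (Fin n → ℝ)
    { toFun := fun u => Complex.exp (-(Complex.I * ((u.toAdd ⬝ᵥ y : ℝ) : ℂ)))
      map_one' := by simp
      map_mul' := fun u v => by
        rw [← Complex.exp_add, toAdd_mul, add_dotProduct]
        push_cast
        ring_nf }

/-- The operator `a ↦ ∑ u, E u a(· + u)` on functions. -/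
def translation (n : ℕ) :
    AddMonoidAlgebra ℂ (Fin n → ℝ) →ₐ[ℂ] Module.End ℂ ((Fin n → ℝ) → ℂ) :=
  AddMonoidAlgebra.lift ℂ (Module.End ℂ ((Fin n → ℝ) → ℂ)) (Fin n → ℝ)
    { toFun := fun u => LinearMap.funLeft ℂ ℂ fun t => t + u.toAdd
      map_one' := by
        ext a t
        simp [LinearMap.funLeft]
      map_mul' := fun u v => by
        refine LinearMap.ext fun a => funext fun t => ?_
        simp [LinearMap.funLeft, add_assoc] }

theorem expSum_single {n : ℕ} (y u : Fin n → ℝ) (c : ℂ) :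
    expSum y (AddMonoidAlgebra.single u c) =
      c * Complex.exp (-(Complex.I * ((u ⬝ᵥ y : ℝ) : ℂ))) := by
  simp [expSum]

theorem translation_single {n : ℕ} (u : Fin n → ℝ) (c : ℂ) (a : (Fin n → ℝ) → ℂ)
    (t : Fin n → ℝ) : translation n (AddMonoidAlgebra.single u c) a t = c * a (t + u) := by
  simp [translation, LinearMap.funLeft]

/-- The Fourier transform exchanges multiplication by an exponential sum and the combination of
translations with the same coefficients. -/
theorem fourier_expSum_mul {n : ℕ} {h : (Fin n → ℝ) → ℂ} (hh : Integrable h)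
    (E : AddMonoidAlgebra ℂ (Fin n → ℝ)) :
    Integrable (fun y => expSum y E * h y) ∧ ∀ t : Fin n → ℝ,
      ∫ y, expSum y E * h y * Complex.exp (-(Complex.I * ((t ⬝ᵥ y : ℝ) : ℂ))) =
        translation n E
          (fun t => ∫ y, h y * Complex.exp (-(Complex.I * ((t ⬝ᵥ y : ℝ) : ℂ)))) t := by
  induction E using AddMonoidAlgebra.induction_linear with
  | zero => simp
  | add E E' hE hE' =>
    refine ⟨?_, fun t => ?_⟩
    · simp only [map_add, add_mul]
      exact hE.1.add hE'.1
    · simp only [map_add, add_mul, LinearMap.add_apply, Pi.add_apply]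
      rw [integral_add (integrable_mul_exp_neg_I_dotProduct hE.1 t)
        (integrable_mul_exp_neg_I_dotProduct hE'.1 t), hE.2, hE'.2]
  | single u c =>
    refine ⟨?_, fun t => ?_⟩
    · refine ((integrable_mul_exp_neg_I_dotProduct hh u).const_mul c).congr (.of_forall fun y => ?_)
      simp only [expSum_single]
      ring
    · rw [translation_single, ← integral_const_mul]
      congr 1
      ext y
      rw [expSum_single, add_dotProduct]
      push_cast
      rw [mul_add, neg_add, Complex.exp_add]
      ring

/-- The exponential `e^{-i u·y}` equals `1` only on countably many parallel hyperplanes. -/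
theorem ae_expSum_sub_one_ne_zero {n : ℕ} {u : Fin n → ℝ} (hu : u ≠ 0) :
    ∀ᵐ y : Fin n → ℝ, expSum y (AddMonoidAlgebra.single u 1 - 1) ≠ 0 := by
  set ℓ : (Fin n → ℝ) →ₗ[ℝ] ℝ := dotProductBilin ℝ ℝ u with hℓ
  have hℓa : ∀ y, ℓ y = u ⬝ᵥ y := fun y => rfl
  have hsurj : Function.Surjective ℓ := by
    refine LinearMap.surjective fun h0 => hu ?_
    rw [← dotProduct_self_eq_zero, ← hℓa, h0, LinearMap.zero_apply]
  have hc : (Set.range fun k : ℤ => -(k * (2 * Real.pi))).Countable := Set.countable_range _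
  have hae := (ae_comp_linearMap_mem_iff ℓ volume volume hsurj hc.measurableSet.compl).2
    (hc.ae_notMem volume)
  filter_upwards [hae] with y hy h0
  rw [map_sub, map_one, expSum_single, one_mul, sub_eq_zero, Complex.exp_eq_one_iff] at h0
  obtain ⟨k, hk⟩ := h0
  refine hy ⟨k, ?_⟩
  have := congrArg Complex.im hk
  simp at this
  simp only [hℓa]
  linarith

/-- Some exponential sum with almost everywhere nonzero values annihilates the function `a`. -/
def IsAnnihilated {n : ℕ} (a : (Fin n → ℝ) → ℂ) : Prop :=
  ∃ E : AddMonoidAlgebra ℂ (Fin n → ℝ), (∀ᵐ y : Fin n → ℝ, expSum y E ≠ 0) ∧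
    translation n E a = 0

theorem IsAnnihilated.add {n : ℕ} {a b : (Fin n → ℝ) → ℂ} (ha : IsAnnihilated a)
    (hb : IsAnnihilated b) : IsAnnihilated (a + b) := by
  obtain ⟨E, hE, ha⟩ := ha
  obtain ⟨E', hE', hb⟩ := hb
  refine ⟨E * E', ?_, ?_⟩
  · filter_upwards [hE, hE'] with y h h'
    rw [map_mul]
    exact mul_ne_zero h h'
  · rw [map_add]
    nth_rw 1 [mul_comm E E']
    rw [map_mul, map_mul, Module.End.mul_apply, Module.End.mul_apply, ha, hb, map_zero, map_zero,
      add_zero]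

/-- Along a direction `u` orthogonal to all `Q ∈ κ`, the fraction `ψ / ∏_{Q ∈ κ} (Q · x)^{m_Q}`
is a polynomial, so that a high power of the difference operator in this direction kills it. -/
theorem isAnnihilated_div {n : ℕ} (δ : Fin n → ℝ) {u : Fin n → ℝ} (hu : u ≠ 0)
    {κ : Finset (Fin n → ℝ)} (hκ : ∀ Q ∈ κ, u ⬝ᵥ Q = 0) (m : (Fin n → ℝ) → ℕ)
    (ψ : MvPolynomial (Fin n) ℂ) :
    IsAnnihilated fun t => MvPolynomial.eval (complexPoint δ t) ψ /
      ∏ Q ∈ κ, MvPolynomial.eval (complexPoint δ t) (linForm Q) ^ m Q := by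
  set a : (Fin n → ℝ) → ℂ := fun t => MvPolynomial.eval (complexPoint δ t) ψ /
      ∏ Q ∈ κ, MvPolynomial.eval (complexPoint δ t) (linForm Q) ^ m Q with ha
  set N := ψ.totalDegree with hN
  refine ⟨(AddMonoidAlgebra.single u 1 - 1) ^ (N + 1), ?_, ?_⟩
  · filter_upwards [ae_expSum_sub_one_ne_zero hu] with y hy
    rw [map_pow]
    exact pow_ne_zero _ hy
  have hΔ : ∀ b, translation n (AddMonoidAlgebra.single u 1 - 1) b = fwdDiff u b := by
    intro b
    ext t
    rw [map_sub, map_one, LinearMap.sub_apply, Pi.sub_apply, translation_single]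
    simp [fwdDiff]
  have hΔ' : ⇑(translation n (AddMonoidAlgebra.single u 1 - 1)) = fwdDiff u := funext hΔ
  rw [map_pow, Module.End.pow_apply, hΔ']
  ext t
  -- the polynomial `k ↦ ψ (z + k i u)` in one variable
  set p : Polynomial ℂ := MvPolynomial.aeval
    (fun j => Polynomial.C (complexPoint δ t j) + Polynomial.C (Complex.I * u j) * Polynomial.X) ψ
    with hp
  have hdeg : p.natDegree < N + 1 := by
    have := MvPolynomial.aeval_natDegree_le (n := 1) ψ hN.ge
      (fun j => Polynomial.C (complexPoint δ t j) + Polynomial.C (Complex.I * u j) * Polynomial.X)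
      fun j => by compute_degree
    rw [mul_one] at this
    exact Nat.lt_succ_of_le this
  have hz : ∀ k : ℕ, complexPoint δ (t + k • u) =
      fun j => complexPoint δ t j + Complex.I * u j * k := by
    intro k
    ext j
    simp [complexPoint]
    ring
  have hpe : ∀ k : ℕ, MvPolynomial.eval (complexPoint δ (t + k • u)) ψ = p.eval (k : ℂ) := by
    intro k
    rw [hz, hp, ← Polynomial.coe_evalRingHom, MvPolynomial.aeval_def, MvPolynomial.hom_eval₂]
    rw [MvPolynomial.eval, MvPolynomial.coe_eval₂Hom]
    congr 1
    · ext c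
      simp
    · ext j
      simp
  have hde : ∀ k : ℕ, a (t + k • u) = (∏ Q ∈ κ,
      MvPolynomial.eval (complexPoint δ t) (linForm Q) ^ m Q)⁻¹ * p.eval (k : ℂ) := by
    intro k
    simp only [ha]
    rw [hpe, div_eq_inv_mul]
    congr 2
    refine Finset.prod_congr rfl fun Q hQ => ?_
    rw [eval_linForm_complexPoint, eval_linForm_complexPoint, add_dotProduct, smul_dotProduct,
      hκ Q hQ, smul_zero, add_zero]
  have h0 := congrFun (Polynomial.fwdDiff_iter_eq_zero_of_degree_lt hdeg) 0
  rw [fwdDiff_iter_eq_sum_shift] at h0 ⊢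
  simp only [hde]
  simp only [zero_add, nsmul_one, Pi.zero_apply] at h0
  simp only [← mul_smul_comm]
  rw [← Finset.mul_sum, h0, mul_zero, Pi.zero_apply]

theorem exists_orthogonal_of_no_basis {n : ℕ} {Qs κ : Finset (Fin n → ℝ)} (hκ : κ ⊆ Qs)
    (h : ∀ σ ∈ jkBases Qs, ¬ σ ⊆ κ) : ∃ u : Fin n → ℝ, u ≠ 0 ∧ ∀ Q ∈ κ, u ⬝ᵥ Q = 0 := by
  classical
  have hlt : Submodule.span ℝ (κ : Set (Fin n → ℝ)) < ⊤ := by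
    refine lt_top_iff_ne_top.2 fun htop => ?_
    obtain ⟨b, hb, hspan, hli⟩ := exists_linearIndependent ℝ (κ : Set (Fin n → ℝ))
    have hfin : b.Finite := κ.finite_toSet.subset hb
    lift b to Finset (Fin n → ℝ) using hfin
    have hb' : b ⊆ κ := Finset.coe_subset.1 hb
    exact h b (Finset.mem_filter.2 ⟨Finset.mem_powerset.2 (hb'.trans hκ), hli,
      hspan.trans htop⟩) hb'
  obtain ⟨f, hf, hle⟩ := Submodule.exists_le_ker_of_lt_top _ hlt
  have hfu : ∀ Q, (fun j => f (Pi.single j 1)) ⬝ᵥ Q = f Q := by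
    intro Q
    conv_rhs => rw [pi_eq_sum_univ' Q]
    simp [dotProduct, map_sum, mul_comm]
  refine ⟨fun j => f (Pi.single j 1), fun h0 => hf ?_, fun Q hQ => ?_⟩
  · ext1 j
    ext
    simpa using congrFun h0 j
  · rw [hfu]
    exact hle (Submodule.subset_span hQ)

/-- On the points `δ + i t`, an element of `NS` is a function killed by translation operators whose
Fourier multiplier is almost everywhere nonzero. -/
theorem exists_hasEval_of_mem_spaceNS {n : ℕ} {Qs : Finset (Fin n → ℝ)} {δ : Fin n → ℝ}
    (hδ : ∀ Q ∈ Qs, 0 < δ ⬝ᵥ Q) {F : LocalField n} (hF : F ∈ spaceNS Qs) :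
    ∃ a, HasEval (complexPoint δ) F a ∧ IsAnnihilated a := by
  induction hF using Submodule.span_induction with
  | mem F h =>
    obtain ⟨κ, hκ, hnb, m, k, ψ, -, -, rfl⟩ := h
    obtain ⟨u, hu, huκ⟩ := exists_orthogonal_of_no_basis hκ hnb
    exact ⟨_, HasEval.div_linProd ψ
      (fun Q hQ t => eval_linForm_complexPoint_ne_zero (hδ Q (hκ hQ)) t) m,
      isAnnihilated_div δ hu huκ m ψ⟩
  | zero => exact ⟨0, HasEval.zero, 1, by simp, by simp⟩
  | add F G _ _ hF hG =>
    obtain ⟨a, ha, ha'⟩ := hF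
    obtain ⟨b, hb, hb'⟩ := hG
    exact ⟨a + b, ha.add hb, ha'.add hb'⟩
  | smul c F _ hF =>
    obtain ⟨a, ha, E, hE, ha'⟩ := hF
    exact ⟨c • a, ha.smul c, E, hE, by rw [map_smul, ha', smul_zero]⟩

/-- A combination of basic fractions that lies in `NS` is zero, and the combination of indicator
functions of cones that corresponds to it under the Laplace transform vanishes almost everywhere.
-/
theorem combination_mem_spaceNS {n : ℕ} {Qs : Finset (Fin n → ℝ)} {δ : Fin n → ℝ}
    (hδ : ∀ Q ∈ Qs, 0 < δ ⬝ᵥ Q) (c : Finset (Fin n → ℝ) → ℂ)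
    (hF : ∑ σ ∈ jkBases Qs, c σ • basicFraction σ ∈ spaceNS Qs) :
    ∑ σ ∈ jkBases Qs, c σ • basicFraction σ = 0 ∧
    ∀ᵐ y : Fin n → ℝ, ∑ σ ∈ jkBases Qs, c σ / (absDet σ : ℂ) *
      (openCone σ).indicator (fun _ => (1 : ℂ)) y = 0 := by
  classical
  set h : (Fin n → ℝ) → ℂ := fun y => ∑ σ ∈ jkBases Qs, c σ / (absDet σ : ℂ) * coneExp σ δ y
    with hh
  have hsub : ∀ σ ∈ jkBases Qs, ∀ Q ∈ σ, 0 < δ ⬝ᵥ Q := fun σ hσ Q hQ =>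
    hδ Q (Finset.mem_powerset.1 (Finset.mem_filter.1 hσ).1 hQ)
  have hlap : ∀ σ ∈ jkBases Qs, ∀ t : Fin n → ℝ,
      Integrable (fun y => coneExp σ δ y * Complex.exp (-(Complex.I * ((t ⬝ᵥ y : ℝ) : ℂ)))) ∧
      ∫ y, coneExp σ δ y * Complex.exp (-(Complex.I * ((t ⬝ᵥ y : ℝ) : ℂ))) =
        (absDet σ : ℂ) * ∏ Q ∈ σ, (MvPolynomial.eval (complexPoint δ t) (linForm Q))⁻¹ := by
    intro σ hσ t
    have hs := hsub σ hσ
    obtain ⟨q, hq, rfl⟩ := exists_enumeration hσ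
    rw [Finset.prod_image fun _ _ _ _ h => hq.injective h]
    exact laplace_openCone hq (fun i => hs _ (by simp)) t
  have hdet : ∀ σ ∈ jkBases Qs, (absDet σ : ℂ) ≠ 0 := by
    intro σ hσ
    obtain ⟨q, hq, rfl⟩ := exists_enumeration hσ
    rw [absDet_image hq.injective]
    exact_mod_cast abs_ne_zero.2 (det_ne_zero_of_linearIndependent hq)
  have hint : Integrable h := by
    refine integrable_finsetSum _ fun σ hσ => Integrable.const_mul ?_ _
    simpa using (hlap σ hσ 0).1
  have hfourier : ∀ t : Fin n → ℝ,
      ∫ y, h y * Complex.exp (-(Complex.I * ((t ⬝ᵥ y : ℝ) : ℂ))) =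
        ∑ σ ∈ jkBases Qs, c σ * ∏ Q ∈ σ, (MvPolynomial.eval (complexPoint δ t) (linForm Q))⁻¹ := by
    intro t
    simp only [hh, Finset.sum_mul, mul_assoc]
    rw [integral_finsetSum _ fun σ hσ => ((hlap σ hσ t).1.const_mul _)]
    refine Finset.sum_congr rfl fun σ hσ => ?_
    rw [integral_const_mul, (hlap σ hσ t).2, ← mul_assoc, div_mul_cancel₀ _ (hdet σ hσ)]
  have heval : HasEval (complexPoint δ) (∑ σ ∈ jkBases Qs, c σ • basicFraction σ) fun t =>
      ∫ y, h y * Complex.exp (-(Complex.I * ((t ⬝ᵥ y : ℝ) : ℂ))) := by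
    have := HasEval.sum (z := complexPoint δ) (s := jkBases Qs) fun σ hσ =>
      (HasEval.basicFraction fun Q hQ t =>
        eval_linForm_complexPoint_ne_zero (hsub σ hσ Q hQ) t).smul (c σ)
    convert this using 1
    ext t
    rw [hfourier]
    simp
  obtain ⟨a, ha, E, hE, hEa⟩ := exists_hasEval_of_mem_spaceNS hδ hF
  obtain rfl := heval.unique ha
  -- the Fourier transform of `h` is annihilated by `E`, and `E` acts on `h` itself as a
  -- multiplication by an almost everywhere nonzero function
  have h0 : h =ᵐ[volume] 0 := by
    obtain ⟨h1, h2⟩ := fourier_expSum_mul hint E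
    have := ae_eq_zero_of_fourier_eq_zero h1 fun t => by rw [h2, hEa, Pi.zero_apply]
    filter_upwards [this, hE] with y hy hy'
    exact (mul_eq_zero.1 hy).resolve_left hy'
  constructor
  · refine HasEval.eq_zero (δ := δ) ?_
    convert heval using 1
    ext t
    rw [integral_eq_zero_of_ae, Pi.zero_apply]
    filter_upwards [h0] with y hy
    simp [hy]
  · filter_upwards [h0] with y hy
    have hexp : Complex.exp (-((δ ⬝ᵥ y : ℝ) : ℂ)) ≠ 0 := Complex.exp_ne_zero _
    apply mul_right_cancel₀ hexp
    rw [zero_mul, Finset.sum_mul, ← show h y = 0 from hy]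
    refine Finset.sum_congr rfl fun σ _ => ?_
    rw [mul_assoc, coneExp]
    by_cases hm : y ∈ openCone σ <;> simp [hm]

/-! ### Existence of the Jeffrey–Kirwan functional -/

/-- Near a generic vector, membership in a simplicial cone is constant: the coordinates of a
generic vector with respect to a basis of `Q_*` are nonzero. -/
theorem eventually_mem_openCone_iff {n : ℕ} {Qs σ : Finset (Fin n → ℝ)} {η : Fin n → ℝ}
    (hσ : σ ∈ jkBases Qs) (hη : IsGenericVector Qs η) :
    ∀ᶠ y in nhds η, (y ∈ openCone σ ↔ η ∈ openCone σ) := by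
  classical
  have hsub := Finset.mem_powerset.1 (Finset.mem_filter.1 hσ).1
  obtain ⟨q, hq, rfl⟩ := exists_enumeration hσ
  let b := Module.Basis.mk hq (hq.span_eq_top_of_card_eq_finrank' (by simp)).ge
  have hb : ∀ i, b i = q i := fun i => by simp [b]
  have hmem : ∀ y, y ∈ openCone (Finset.univ.image q) ↔ ∀ i, 0 < b.coord i y := by
    intro y
    constructor
    · rintro ⟨a, ha, rfl⟩ i
      rw [Finset.sum_image fun _ _ _ _ h => hq.injective h]
      simp only [map_sum, map_smul, ← hb, Module.Basis.coord_apply, Module.Basis.repr_self]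
      simp [Finsupp.single_apply, hb, ha]
    · intro h
      refine ⟨Function.extend q (fun i => b.coord i y) 1, fun Q hQ => ?_, ?_⟩
      · obtain ⟨i, -, rfl⟩ := Finset.mem_image.1 hQ
        rw [hq.injective.extend_apply]
        exact h i
      · rw [Finset.sum_image fun _ _ _ _ h => hq.injective h]
        simp only [hq.injective.extend_apply]
        simp only [← hb, Module.Basis.coord_apply]
        exact (b.sum_repr y).symm
  have hne : ∀ i, b.coord i η ≠ 0 := by
    intro i h0
    refine hη ((Finset.univ.erase i).image q) (fun Q hQ => hsub ?_) ?_ ?_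
    · exact Finset.image_subset_image (Finset.erase_subset _ _) hQ
    · rw [Finset.card_image_of_injective _ hq.injective, Finset.card_erase_of_mem (by simp),
        Finset.card_univ, Fintype.card_fin]
      have := i.pos
      omega
    · rw [← b.sum_repr η]
      refine Submodule.sum_mem _ fun j _ => ?_
      by_cases hij : j = i
      · subst hij
        rw [← Module.Basis.coord_apply, h0, zero_smul]
        exact Submodule.zero_mem _
      · refine Submodule.smul_mem _ _ (Submodule.subset_span ?_)
        rw [hb]
        exact Finset.mem_coe.2 (Finset.mem_image_of_mem q (by simp [hij]))
  have hev : ∀ i, ∀ᶠ y in nhds η, (0 < b.coord i y ↔ 0 < b.coord i η) := by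
    intro i
    have hc : ContinuousAt (b.coord i) η :=
      (b.coord i).continuous_of_finiteDimensional.continuousAt
    rcases lt_or_gt_of_ne (hne i) with h | h
    · filter_upwards [hc.eventually_lt_const h] with y hy
      exact ⟨fun h' => absurd h' hy.not_gt, fun h' => absurd h' h.not_gt⟩
    · filter_upwards [hc.eventually_const_lt h] with y hy
      exact ⟨fun _ => h, fun _ => hy⟩
  filter_upwards [Filter.eventually_all.2 hev] with y hy
  rw [hmem, hmem]
  exact forall_congr' hy

theorem exists_coeff_of_mem_spaceS {n : ℕ} {Qs : Finset (Fin n → ℝ)} {F : LocalField n}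
    (hF : F ∈ spaceS Qs) : ∃ c : Finset (Fin n → ℝ) → ℂ,
      F = ∑ σ ∈ jkBases Qs, c σ • basicFraction σ := by
  have : {F | ∃ σ ∈ jkBases Qs, F = basicFraction σ} = basicFraction '' (jkBases Qs : Set _) := by
    ext F
    simp [eq_comm]
  rw [spaceS, this, Submodule.mem_span_image_finset_iff_exists_fun'] at hF
  obtain ⟨c, hc⟩ := hF
  exact ⟨c, hc.symm⟩

theorem eq_zero_of_mem_spaceS_of_mem_spaceNS {n : ℕ} {Qs : Finset (Fin n → ℝ)}
    (hproj : IsProjectiveSet Qs) {F : LocalField n} (hS : F ∈ spaceS Qs) (hNS : F ∈ spaceNS Qs) :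
    F = 0 := by
  obtain ⟨δ, hδ⟩ := hproj
  obtain ⟨c, rfl⟩ := exists_coeff_of_mem_spaceS hS
  exact (combination_mem_spaceNS hδ c hNS).1

open Classical in
/-- The value prescribed for the Jeffrey–Kirwan functional at the basic fraction of `σ`. -/
def jkWeight {n : ℕ} (η : Fin n → ℝ) (σ : Finset (Fin n → ℝ)) : ℂ :=
  if η ∈ openCone σ then ((absDet σ)⁻¹ : ℝ) else 0

/-- The prescribed values satisfy every linear relation between the basic fractions. -/
theorem sum_jkWeight_eq_zero {n : ℕ} {Qs : Finset (Fin n → ℝ)} {η : Fin n → ℝ}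
    (hproj : IsProjectiveSet Qs) (hη : IsGenericVector Qs η) {c : Finset (Fin n → ℝ) → ℂ}
    (hc : ∑ σ ∈ jkBases Qs, c σ • basicFraction σ = 0) :
    ∑ σ ∈ jkBases Qs, c σ * jkWeight η σ = 0 := by
  obtain ⟨δ, hδ⟩ := hproj
  have hae := (combination_mem_spaceNS hδ c (hc ▸ Submodule.zero_mem _)).2
  have hev : ∀ᶠ y in nhds η, ∀ σ ∈ jkBases Qs, (y ∈ openCone σ ↔ η ∈ openCone σ) :=
    (Filter.eventually_all_finset _).2 fun σ hσ => eventually_mem_openCone_iff hσ hη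
  obtain ⟨y, hy, hy'⟩ := (Measure.dense_of_ae hae).inter_nhds_nonempty hev
  rw [← show _ = (0 : ℂ) from hy]
  refine Finset.sum_congr rfl fun σ hσ => ?_
  by_cases h : η ∈ openCone σ
  · simp [jkWeight, h, (hy' σ hσ).2 h, div_eq_mul_inv]
  · simp [jkWeight, h, mt (hy' σ hσ).1 h]

theorem exists_isJKFunctional {n : ℕ} {Qs : Finset (Fin n → ℝ)} {η : Fin n → ℝ}
    (hproj : IsProjectiveSet Qs) (hη : IsGenericVector Qs η) :
    ∃ J, IsJKFunctional Qs η J := by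
  classical
  -- `ℓ` carries the prescribed values on formal combinations of bases; it descends along `P` to `S`
  let P : (Finset (Fin n → ℝ) → ℂ) →ₗ[ℂ] spaceS Qs :=
    { toFun := fun c => ∑ σ ∈ (jkBases Qs).attach,
        c σ • ⟨basicFraction σ.1, Submodule.subset_span ⟨σ.1, σ.2, rfl⟩⟩
      map_add' := fun c d => by simp [add_smul, Finset.sum_add_distrib]
      map_smul' := fun r c => by simp [mul_smul, Finset.smul_sum] }
  have hP : ∀ c, (P c : LocalField n) = ∑ σ ∈ jkBases Qs, c σ • basicFraction σ := by
    intro c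
    simp only [P, LinearMap.coe_mk, AddHom.coe_mk, AddSubmonoidClass.coe_finsetSum,
      SetLike.val_smul]
    exact Finset.sum_attach (jkBases Qs) fun σ => c σ • basicFraction σ
  let ℓ : (Finset (Fin n → ℝ) → ℂ) →ₗ[ℂ] ℂ :=
    ∑ σ ∈ jkBases Qs, jkWeight η σ • LinearMap.proj σ
  have hℓ : ∀ c, ℓ c = ∑ σ ∈ jkBases Qs, c σ * jkWeight η σ := by
    intro c
    simp [ℓ, LinearMap.sum_apply, mul_comm]
  have hsurj : Function.Surjective P := by
    rintro ⟨F, hF⟩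
    obtain ⟨c, hc⟩ := exists_coeff_of_mem_spaceS hF
    exact ⟨c, Subtype.ext ((hP c).trans hc.symm)⟩
  have hker : ∀ c d, P c = P d → ℓ c = ℓ d := by
    intro c d h
    rw [← sub_eq_zero, ← map_sub, hℓ]
    refine sum_jkWeight_eq_zero hproj hη ?_
    rw [← hP, map_sub, h, sub_self, Submodule.coe_zero]
  obtain ⟨r, hr⟩ := P.exists_rightInverse_of_surjective (LinearMap.range_eq_top.2 hsurj)
  have hJ : ∀ (σ : Finset (Fin n → ℝ)) (hσ : σ ∈ jkBases Qs),
      ℓ (r ⟨basicFraction σ, Submodule.subset_span ⟨σ, hσ, rfl⟩⟩) = jkWeight η σ := by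
    intro σ hσ
    rw [hker _ (Pi.single σ 1), hℓ]
    · rw [Finset.sum_eq_single σ (fun τ _ h => by simp [h]) fun h => absurd hσ h]
      simp
    · rw [← LinearMap.comp_apply, hr]
      apply Subtype.ext
      rw [hP, Finset.sum_eq_single σ (fun τ _ h => by simp [h]) fun h => absurd hσ h]
      simp
  exact ⟨ℓ ∘ₗ r, fun σ hσ => ⟨fun h => by rw [LinearMap.comp_apply, hJ σ hσ, jkWeight, if_pos h],
    fun h => by rw [LinearMap.comp_apply, hJ σ hσ, jkWeight, if_neg h]⟩⟩

/-- For projective `Q_*` and generic `η`, the functional is the one with the prescribed values. -/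
theorem jkFunctional_apply {n : ℕ} {Qs : Finset (Fin n → ℝ)} {η : Fin n → ℝ}
    (hproj : IsProjectiveSet Qs) (hη : IsGenericVector Qs η) {s : spaceS Qs}
    {c : Finset (Fin n → ℝ) → ℂ}
    (hs : (s : LocalField n) = ∑ σ ∈ jkBases Qs, c σ • basicFraction σ) :
    jkFunctional Qs η s = ∑ σ ∈ jkBases Qs, c σ * jkWeight η σ := by
  classical
  have hex := exists_isJKFunctional hproj hη
  have hJ : IsJKFunctional Qs η (jkFunctional Qs η) := by
    rw [jkFunctional, dif_pos hex]
    exact hex.choose_spec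
  have hs' : s = ∑ σ ∈ (jkBases Qs).attach,
      c σ • ⟨basicFraction σ.1, Submodule.subset_span ⟨σ.1, σ.2, rfl⟩⟩ := by
    apply Subtype.ext
    simp only [AddSubmonoidClass.coe_finsetSum, SetLike.val_smul]
    rw [hs]
    exact (Finset.sum_attach (jkBases Qs) fun σ => c σ • basicFraction σ).symm
  rw [hs', map_sum, ← Finset.sum_attach (jkBases Qs)]
  refine Finset.sum_congr rfl fun σ _ => ?_
  rw [map_smul, smul_eq_mul, jkWeight]
  split_ifs with h
  · rw [(hJ σ.1 σ.2).1 h]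
  · rw [(hJ σ.1 σ.2).2 h]

/-! ### Uniqueness of homogeneous parts and of the projection to `S` -/

theorem linForm_ne_zero {n : ℕ} {Q : Fin n → ℝ} (hQ : Q ≠ 0) : linForm Q ≠ 0 := by
  intro h
  apply hQ
  ext j
  have := congrArg (MvPolynomial.eval (Pi.single j 1)) h
  rw [eval_linForm, map_zero, Finset.sum_eq_single j (fun i _ h => by simp [h]) (by simp)] at this
  simpa using this

theorem isHomogeneous_linForm {n : ℕ} (Q : Fin n → ℝ) : (linForm Q).IsHomogeneous 1 :=
  MvPolynomial.IsHomogeneous.sum _ _ _ fun j _ => by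
    simpa using (MvPolynomial.isHomogeneous_C _ _).mul (MvPolynomial.isHomogeneous_X ℂ j)

theorem isHomogeneous_prod_linForm {n : ℕ} (κ : Finset (Fin n → ℝ)) (m : (Fin n → ℝ) → ℕ) :
    (∏ Q ∈ κ, linForm Q ^ m Q).IsHomogeneous (∑ Q ∈ κ, m Q) :=
  MvPolynomial.IsHomogeneous.prod _ _ _ fun Q _ => by
    simpa using (isHomogeneous_linForm Q).pow (m Q)

theorem linProd_eq {n : ℕ} (κ : Finset (Fin n → ℝ)) (m : (Fin n → ℝ) → ℕ) :
    linProd κ m = algebraMap (MvPowerSeries (Fin n) ℂ) (LocalField n)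
      ((∏ Q ∈ κ, linForm Q ^ m Q : MvPolynomial (Fin n) ℂ) : MvPowerSeries (Fin n) ℂ) := by
  have : linProd κ m = polyToLocal (∏ Q ∈ κ, linForm Q ^ m Q) := by
    simp [linProd, polyToLocal_eq]
  rw [this, polyToLocal]

theorem linProd_ne_zero {n : ℕ} {κ : Finset (Fin n → ℝ)} (hκ : ∀ Q ∈ κ, Q ≠ 0)
    (m : (Fin n → ℝ) → ℕ) : linProd κ m ≠ 0 := by
  refine Finset.prod_ne_zero_iff.2 fun Q hQ => pow_ne_zero _ ?_
  rw [polyToLocal_eq]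
  exact (map_ne_zero_iff _ (polyToLocalHom_injective n)).2 (linForm_ne_zero (hκ Q hQ))

theorem homogeneousComponent_mul_coe {n e : ℕ} {p : MvPolynomial (Fin n) ℂ}
    (hp : p.IsHomogeneous e) (f : MvPowerSeries (Fin n) ℂ) (k : ℕ) :
    MvPowerSeries.homogeneousComponent (k + e) (f * (p : MvPowerSeries (Fin n) ℂ)) =
      MvPowerSeries.homogeneousComponent k f * (p : MvPowerSeries (Fin n) ℂ) := by
  ext d
  have hterm : ∀ ab ∈ Finset.HasAntidiagonal.antidiagonal d,
      MvPowerSeries.coeff ab.1 (MvPowerSeries.homogeneousComponent k f) *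
        MvPowerSeries.coeff ab.2 (p : MvPowerSeries (Fin n) ℂ) =
      if d.degree = k + e then MvPowerSeries.coeff ab.1 f *
        MvPowerSeries.coeff ab.2 (p : MvPowerSeries (Fin n) ℂ) else 0 := by
    intro ab hab
    have hd := congrArg Finsupp.degree (Finset.HasAntidiagonal.mem_antidiagonal.1 hab)
    rw [map_add] at hd
    rw [MvPolynomial.coeff_coe, MvPowerSeries.coeff_homogeneousComponent]
    by_cases hb : ab.2.degree = e
    · have : ab.1.degree = k ↔ d.degree = k + e := by omega
      simp [this]
    · simp [hp.coeff_eq_zero hb]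
  rw [MvPowerSeries.coeff_homogeneousComponent, MvPowerSeries.coeff_mul, MvPowerSeries.coeff_mul,
    Finset.sum_congr rfl hterm]
  split_ifs <;> simp

theorem homogeneousComponent_mul_coe_of_lt {n e k : ℕ} {p : MvPolynomial (Fin n) ℂ}
    (hp : p.IsHomogeneous e) (f : MvPowerSeries (Fin n) ℂ) (hk : k < e) :
    MvPowerSeries.homogeneousComponent k (f * (p : MvPowerSeries (Fin n) ℂ)) = 0 := by
  ext d
  rw [MvPowerSeries.coeff_homogeneousComponent, map_zero]
  split_ifs with h
  · rw [MvPowerSeries.coeff_mul]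
    refine Finset.sum_eq_zero fun ab hab => ?_
    rw [MvPolynomial.coeff_coe, hp.coeff_eq_zero, mul_zero]
    have := congrArg Finsupp.degree (Finset.HasAntidiagonal.mem_antidiagonal.1 hab)
    rw [map_add] at this
    omega
  · rfl

/-- The homogeneous parts of an element of `R̂` do not depend on the chosen denominator. -/
theorem IsDegreePart.unique {n : ℕ} {Qs : Finset (Fin n → ℝ)} (h0 : ∀ Q ∈ Qs, Q ≠ 0) {d : ℤ}
    {F G G' : LocalField n} (h : IsDegreePart Qs d F G) (h' : IsDegreePart Qs d F G') :
    G = G' := by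
  obtain ⟨f, m, hF, hG⟩ := h
  obtain ⟨f', m', hF', hG'⟩ := h'
  have hL := linProd_ne_zero h0 m
  have hL' := linProd_ne_zero h0 m'
  have hp := isHomogeneous_prod_linForm Qs m
  have hp' := isHomogeneous_prod_linForm Qs m'
  have hinj : Function.Injective (algebraMap (MvPowerSeries (Fin n) ℂ) (LocalField n)) :=
    IsFractionRing.injective _ _
  rw [hF, div_eq_div_iff hL hL', linProd_eq, linProd_eq, ← map_mul, ← map_mul] at hF'
  have heq := hinj hF'
  have hm : (∑ Q ∈ Qs, (m Q : ℤ)) = ((∑ Q ∈ Qs, m Q : ℕ) : ℤ) := by push_cast; rfl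
  have hm' : (∑ Q ∈ Qs, (m' Q : ℤ)) = ((∑ Q ∈ Qs, m' Q : ℕ) : ℤ) := by push_cast; rfl
  rw [hm] at hG
  rw [hm'] at hG'
  rcases hG with ⟨k, hk, rfl⟩ | ⟨hk, rfl⟩ <;> rcases hG' with ⟨k', hk', rfl⟩ | ⟨hk', rfl⟩
  · rw [div_eq_div_iff hL hL', linProd_eq, linProd_eq, ← map_mul, ← map_mul,
      ← homogeneousComponent_mul_coe hp', ← homogeneousComponent_mul_coe hp, heq]
    congr 3
    omega
  · rw [div_eq_zero_iff]
    left
    have h1 := homogeneousComponent_mul_coe hp' f k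
    rw [heq, homogeneousComponent_mul_coe_of_lt hp _ (by omega)] at h1
    have h2 := congrArg (algebraMap _ (LocalField n)) h1
    rw [map_mul, map_zero, ← linProd_eq] at h2
    exact (mul_eq_zero.1 h2.symm).resolve_right hL'
  · rw [eq_comm, div_eq_zero_iff]
    left
    have h1 := homogeneousComponent_mul_coe hp f' k'
    rw [← heq, homogeneousComponent_mul_coe_of_lt hp' _ (by omega)] at h1
    have h2 := congrArg (algebraMap _ (LocalField n)) h1
    rw [map_mul, map_zero, ← linProd_eq] at h2
    exact (mul_eq_zero.1 h2.symm).resolve_right hL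
  · rfl

theorem IsProjectiveSet.ne_zero {n : ℕ} {Qs : Finset (Fin n → ℝ)} (h : IsProjectiveSet Qs) :
    ∀ Q ∈ Qs, Q ≠ 0 := by
  obtain ⟨δ, hδ⟩ := h
  rintro Q hQ rfl
  simpa using hδ 0 hQ

/-- Since `S ∩ NS = 0`, the component in `S` of an element of `R̂` is unique. -/
theorem simplePart_eq {n : ℕ} {Qs : Finset (Fin n → ℝ)} (hproj : IsProjectiveSet Qs)
    {F G : LocalField n} {s : spaceS Qs} (hG : IsDegreePart Qs (-(n : ℤ)) F G)
    (hs : G - (s : LocalField n) ∈ spaceNS Qs) : simplePart Qs F = s := by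
  have hex : ∃ s : spaceS Qs, ∃ G, IsDegreePart Qs (-(n : ℤ)) F G ∧
      G - (s : LocalField n) ∈ spaceNS Qs := ⟨s, G, hG, hs⟩
  rw [simplePart, dif_pos hex]
  obtain ⟨G', hG', hs'⟩ := hex.choose_spec
  obtain rfl := hG.unique hproj.ne_zero hG'
  rw [← sub_eq_zero]
  apply Subtype.ext
  refine eq_zero_of_mem_spaceS_of_mem_spaceNS hproj (hex.choose - s).2 ?_
  have := Submodule.sub_mem _ hs hs'
  rwa [sub_sub_sub_cancel_left] at this

/-! ### Orthogonal substitutions -/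

/-- The substitution `x ↦ gᵀ x` on polynomials. For orthogonal `g`, where `gᵀ = g⁻¹`, it sends the
linear form of `Q` to that of `g Q`. -/
def polySubst {n : ℕ} (g : Matrix (Fin n) (Fin n) ℝ) :
    MvPolynomial (Fin n) ℂ →ₐ[ℂ] MvPolynomial (Fin n) ℂ :=
  MvPolynomial.aeval fun j => linForm fun i => g i j

theorem polySubst_linForm {n : ℕ} (g : Matrix (Fin n) (Fin n) ℝ) (Q : Fin n → ℝ) :
    polySubst g (linForm Q) = linForm (g.mulVec Q) := by
  simp only [polySubst, linForm, map_sum, map_mul, MvPolynomial.aeval_X, MvPolynomial.algHom_C,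
    Finset.mul_sum, Matrix.mulVec, dotProduct, Complex.ofReal_sum, Complex.ofReal_mul,
    Finset.sum_mul, MvPolynomial.algebraMap_eq]
  rw [Finset.sum_comm]
  exact Finset.sum_congr rfl fun i _ => Finset.sum_congr rfl fun j _ => by ring

theorem hasSubst_linForm {n : ℕ} (g : Matrix (Fin n) (Fin n) ℝ) :
    MvPowerSeries.HasSubst fun j =>
      ((linForm fun i => g i j : MvPolynomial (Fin n) ℂ) : MvPowerSeries (Fin n) ℂ) := by
  refine MvPowerSeries.hasSubst_of_constantCoeff_zero fun j => ?_
  rw [← MvPowerSeries.coeff_zero_eq_constantCoeff_apply, MvPolynomial.coeff_coe]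
  exact (isHomogeneous_linForm _).coeff_eq_zero (by simp)

/-- The substitution `x ↦ gᵀ x` on formal power series. -/
def seriesSubst {n : ℕ} (g : Matrix (Fin n) (Fin n) ℝ) :
    MvPowerSeries (Fin n) ℂ →ₐ[ℂ] MvPowerSeries (Fin n) ℂ :=
  MvPowerSeries.substAlgHom (hasSubst_linForm g)

theorem seriesSubst_coe {n : ℕ} (g : Matrix (Fin n) (Fin n) ℝ) (p : MvPolynomial (Fin n) ℂ) :
    seriesSubst g (p : MvPowerSeries (Fin n) ℂ) =
      (polySubst g p : MvPowerSeries (Fin n) ℂ) := by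
  rw [seriesSubst, MvPowerSeries.substAlgHom_coe]
  have : MvPolynomial.aeval (fun j =>
      ((linForm fun i => g i j : MvPolynomial (Fin n) ℂ) : MvPowerSeries (Fin n) ℂ)) =
      (MvPolynomial.coeToMvPowerSeries.algHom ℂ).comp (polySubst g) := by
    apply MvPolynomial.algHom_ext
    intro j
    simp [polySubst, MvPolynomial.coeToMvPowerSeries.algHom_apply]
  rw [this]
  simp [MvPolynomial.coeToMvPowerSeries.algHom_apply]

theorem seriesSubst_seriesSubst {n : ℕ} (g h : Matrix (Fin n) (Fin n) ℝ)
    (f : MvPowerSeries (Fin n) ℂ) : seriesSubst g (seriesSubst h f) = seriesSubst (g * h) f := by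
  have : (fun j => MvPowerSeries.substAlgHom (hasSubst_linForm g)
      ((linForm fun i => h i j : MvPolynomial (Fin n) ℂ) : MvPowerSeries (Fin n) ℂ)) =
      fun j => ((linForm fun i => (g * h) i j : MvPolynomial (Fin n) ℂ) :
        MvPowerSeries (Fin n) ℂ) := by
    ext1 j
    exact (seriesSubst_coe g _).trans (by rw [polySubst_linForm]; rfl)
  change MvPowerSeries.substAlgHom (hasSubst_linForm g)
    (MvPowerSeries.substAlgHom (hasSubst_linForm h) f) =
      MvPowerSeries.substAlgHom (hasSubst_linForm (g * h)) f
  rw [MvPowerSeries.substAlgHom_comp_substAlgHom_apply, MvPowerSeries.substAlgHom_apply,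
    MvPowerSeries.substAlgHom_apply, this]

theorem seriesSubst_one {n : ℕ} (f : MvPowerSeries (Fin n) ℂ) : seriesSubst 1 f = f := by
  rw [seriesSubst, MvPowerSeries.substAlgHom_apply]
  have : (fun j => ((linForm fun i => (1 : Matrix (Fin n) (Fin n) ℝ) i j :
      MvPolynomial (Fin n) ℂ) : MvPowerSeries (Fin n) ℂ)) = MvPowerSeries.X := by
    ext1 j
    rw [← MvPolynomial.coe_X]
    congr 1
    rw [linForm, Finset.sum_eq_single j (fun i _ h => by simp [h]) (by simp)]
    simp
  rw [this, MvPowerSeries.subst_self, id]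

/-- A linear substitution preserves the degree. -/
theorem homogeneousComponent_seriesSubst {n : ℕ} (g : Matrix (Fin n) (Fin n) ℝ) (k : ℕ)
    (f : MvPowerSeries (Fin n) ℂ) :
    MvPowerSeries.homogeneousComponent k (seriesSubst g f) =
      seriesSubst g (MvPowerSeries.homogeneousComponent k f) := by
  ext e
  rw [MvPowerSeries.coeff_homogeneousComponent, seriesSubst, MvPowerSeries.substAlgHom_apply,
    MvPowerSeries.substAlgHom_apply, MvPowerSeries.coeff_subst (hasSubst_linForm g),
    MvPowerSeries.coeff_subst (hasSubst_linForm g)]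
  -- a monomial of degree `r` is sent to a form of degree `r`
  have hz : ∀ d : Fin n →₀ ℕ, e.degree ≠ d.degree →
      MvPowerSeries.coeff e (d.prod fun s r => ((linForm fun i => g i s :
        MvPolynomial (Fin n) ℂ) : MvPowerSeries (Fin n) ℂ) ^ r) = 0 := by
    intro d hd
    have hcoe : (d.prod fun s r => ((linForm fun i => g i s :
        MvPolynomial (Fin n) ℂ) : MvPowerSeries (Fin n) ℂ) ^ r) =
        ((d.prod fun s r => (linForm fun i => g i s) ^ r : MvPolynomial (Fin n) ℂ) :
          MvPowerSeries (Fin n) ℂ) := by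
      simp only [Finsupp.prod, ← MvPolynomial.coeToMvPowerSeries.ringHom_apply, map_prod, map_pow]
    rw [hcoe, MvPolynomial.coeff_coe]
    refine MvPolynomial.IsHomogeneous.coeff_eq_zero (n := d.degree) ?_ hd
    exact MvPolynomial.IsHomogeneous.prod _ _ _ fun s _ => by
      simpa using (isHomogeneous_linForm fun i => g i s).pow (d s)
  split_ifs with he
  · refine finsum_congr fun d => ?_
    rw [MvPowerSeries.coeff_homogeneousComponent]
    split_ifs with hd
    · rfl
    · rw [hz d (by omega), smul_zero, smul_zero]
  · rw [eq_comm]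
    apply finsum_eq_zero_of_forall_eq_zero
    intro d
    rw [MvPowerSeries.coeff_homogeneousComponent]
    split_ifs with hd
    · rw [hz d (by omega), smul_zero]
    · rw [zero_smul]

section Orthogonal

variable {n : ℕ} (g : Matrix.orthogonalGroup (Fin n) ℝ)

theorem coe_inv_mul_coe : (g⁻¹).1 * g.1 = 1 := by
  rw [← Submonoid.coe_mul, inv_mul_cancel]
  rfl

theorem inv_mulVec_mulVec (Q : Fin n → ℝ) : (g⁻¹).1.mulVec (g.1.mulVec Q) = Q := by
  rw [Matrix.mulVec_mulVec, coe_inv_mul_coe, Matrix.one_mulVec]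

theorem mulVec_injective : Function.Injective g.1.mulVec :=
  Function.LeftInverse.injective (inv_mulVec_mulVec g)

theorem seriesSubst_injective : Function.Injective (seriesSubst g.1) :=
  Function.LeftInverse.injective (g := seriesSubst (g⁻¹).1) fun f => by
    rw [seriesSubst_seriesSubst, coe_inv_mul_coe, seriesSubst_one]

theorem algebraMap_comp_seriesSubst_injective :
    Function.Injective ((IsScalarTower.toAlgHom ℂ (MvPowerSeries (Fin n) ℂ) (LocalField n)).comp
      (seriesSubst g.1)) :=
  (IsFractionRing.injective (MvPowerSeries (Fin n) ℂ) (LocalField n)).comp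
    (seriesSubst_injective g)

/-- The substitution `x ↦ g⁻¹ x` on the fraction field of the ring of formal power series. -/
def localSubst : LocalField n →ₐ[ℂ] LocalField n :=
  IsFractionRing.liftAlgHom (algebraMap_comp_seriesSubst_injective g)

theorem localSubst_algebraMap (f : MvPowerSeries (Fin n) ℂ) :
    localSubst g (algebraMap _ (LocalField n) f) = algebraMap _ _ (seriesSubst g.1 f) :=
  IsFractionRing.lift_algebraMap (algebraMap_comp_seriesSubst_injective g) f

theorem localSubst_polyToLocal (p : MvPolynomial (Fin n) ℂ) :
    localSubst g (polyToLocal p) = polyToLocal (polySubst g.1 p) := by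
  rw [polyToLocal, localSubst_algebraMap, seriesSubst_coe, polyToLocal]

theorem localSubst_inv (F : LocalField n) : localSubst g⁻¹ (localSubst g F) = F := by
  obtain ⟨a, b, -, rfl⟩ := IsFractionRing.div_surjective (MvPowerSeries (Fin n) ℂ) F
  simp only [map_div₀, localSubst_algebraMap, seriesSubst_seriesSubst, coe_inv_mul_coe,
    seriesSubst_one]

theorem rotateSet_inv (σ : Finset (Fin n → ℝ)) : rotateSet g⁻¹ (rotateSet g σ) = σ := by
  classical
  ext Q
  simp [rotateSet]

theorem sum_rotateSet {M : Type*} [AddCommMonoid M] (σ : Finset (Fin n → ℝ))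
    (f : (Fin n → ℝ) → M) : ∑ Q ∈ rotateSet g σ, f Q = ∑ Q ∈ σ, f (g.1.mulVec Q) := by
  classical
  exact Finset.sum_image fun _ _ _ _ h => mulVec_injective g h

theorem prod_rotateSet {M : Type*} [CommMonoid M] (σ : Finset (Fin n → ℝ))
    (f : (Fin n → ℝ) → M) : ∏ Q ∈ rotateSet g σ, f Q = ∏ Q ∈ σ, f (g.1.mulVec Q) := by
  classical
  exact Finset.prod_image fun _ _ _ _ h => mulVec_injective g h

theorem rotateSet_subset {σ τ : Finset (Fin n → ℝ)} (h : σ ⊆ τ) :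
    rotateSet g σ ⊆ rotateSet g τ := by
  classical
  exact Finset.image_subset_image h

theorem rotateSet_image (q : Fin n → Fin n → ℝ) [DecidableEq (Fin n → ℝ)] :
    rotateSet g (Finset.univ.image q) = Finset.univ.image fun i => g.1.mulVec (q i) := by
  ext Q
  simp [rotateSet]

theorem linearIndependent_mulVec {q : Fin n → Fin n → ℝ} (hq : LinearIndependent ℝ q) :
    LinearIndependent ℝ fun i => g.1.mulVec (q i) := by
  refine hq.map' (Matrix.mulVecLin g.1) (LinearMap.ker_eq_bot.2 fun x y h => ?_)
  exact mulVec_injective g h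

theorem mem_jkBases_of_linearIndependent {Qs : Finset (Fin n → ℝ)} [DecidableEq (Fin n → ℝ)]
    {q : Fin n → Fin n → ℝ}
    (hq : LinearIndependent ℝ q) (hs : Finset.univ.image q ⊆ Qs) :
    Finset.univ.image q ∈ jkBases Qs := by
  classical
  have hr : ((Finset.univ.image q : Finset (Fin n → ℝ)) : Set (Fin n → ℝ)) = Set.range q := by
    simp
  refine Finset.mem_filter.2 ⟨Finset.mem_powerset.2 hs, ?_, ?_⟩
  · have := hq.linearIndepOn_id
    rw [← hr] at this
    exact this
  · rw [hr]
    exact hq.span_eq_top_of_card_eq_finrank' (by simp)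

theorem rotateSet_mem_jkBases {Qs σ : Finset (Fin n → ℝ)} (hσ : σ ∈ jkBases Qs) :
    rotateSet g σ ∈ jkBases (rotateSet g Qs) := by
  classical
  have hsub := Finset.mem_powerset.1 (Finset.mem_filter.1 hσ).1
  obtain ⟨q, hq, rfl⟩ := exists_enumeration hσ
  have := rotateSet_subset g hsub
  rw [rotateSet_image] at this ⊢
  exact mem_jkBases_of_linearIndependent (linearIndependent_mulVec g hq) this

theorem rotateSet_mem_jkBases_iff {Qs σ : Finset (Fin n → ℝ)} :
    rotateSet g σ ∈ jkBases (rotateSet g Qs) ↔ σ ∈ jkBases Qs := by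
  refine ⟨fun h => ?_, rotateSet_mem_jkBases g⟩
  simpa only [rotateSet_inv] using rotateSet_mem_jkBases g⁻¹ h

theorem rotateSet_rotateSet_inv (σ : Finset (Fin n → ℝ)) :
    rotateSet g (rotateSet g⁻¹ σ) = σ := by
  simpa using rotateSet_inv g⁻¹ σ

theorem sum_jkBases_rotateSet {M : Type*} [AddCommMonoid M] (Qs : Finset (Fin n → ℝ))
    (f : Finset (Fin n → ℝ) → M) :
    ∑ σ ∈ jkBases (rotateSet g Qs), f σ = ∑ σ ∈ jkBases Qs, f (rotateSet g σ) := by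
  refine Finset.sum_nbij' (rotateSet g⁻¹) (rotateSet g) (fun σ hσ => ?_)
    (fun σ hσ => rotateSet_mem_jkBases g hσ) (fun σ _ => rotateSet_rotateSet_inv g σ)
    (fun σ _ => rotateSet_inv g σ) (fun σ _ => by rw [rotateSet_rotateSet_inv])
  rw [← rotateSet_mem_jkBases_iff g, rotateSet_rotateSet_inv]
  exact hσ

theorem absDet_rotateSet {Qs σ : Finset (Fin n → ℝ)} (hσ : σ ∈ jkBases Qs) :
    absDet (rotateSet g σ) = absDet σ := by
  classical
  obtain ⟨q, hq, rfl⟩ := exists_enumeration hσ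
  rw [rotateSet_image, absDet_image (linearIndependent_mulVec g hq).injective,
    absDet_image hq.injective]
  have h1 : (Matrix.of fun i => g.1.mulVec (q i)) = Matrix.of q * g.1.transpose := by
    ext i j
    simp [Matrix.mulVec, Matrix.mul_apply, dotProduct, mul_comm]
  have h2 : |g.1.det| = 1 := by
    have := congrArg Matrix.det ((Matrix.mem_orthogonalGroup_iff (Fin n) ℝ).1 g.2)
    rw [Matrix.det_mul, Matrix.det_transpose, Matrix.det_one] at this
    rcases mul_self_eq_one_iff.1 this with h | h <;> simp [h]
  rw [h1, Matrix.det_mul, abs_mul, Matrix.det_transpose, h2, mul_one]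

theorem localSubst_basicFraction (σ : Finset (Fin n → ℝ)) :
    localSubst g (basicFraction σ) = basicFraction (rotateSet g σ) := by
  simp only [basicFraction, map_div₀, map_one, map_prod, localSubst_polyToLocal,
    polySubst_linForm, prod_rotateSet]

theorem localSubst_linProd (κ : Finset (Fin n → ℝ)) (m : (Fin n → ℝ) → ℕ) :
    localSubst g (linProd κ m) = linProd (rotateSet g κ) fun Q => m ((g⁻¹).1.mulVec Q) := by
  simp only [linProd, map_prod, map_pow, localSubst_polyToLocal, polySubst_linForm,
    prod_rotateSet, inv_mulVec_mulVec]

theorem localSubst_mem_spaceS {Qs : Finset (Fin n → ℝ)} {F : LocalField n} (hF : F ∈ spaceS Qs) :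
    localSubst g F ∈ spaceS (rotateSet g Qs) := by
  obtain ⟨c, rfl⟩ := exists_coeff_of_mem_spaceS hF
  rw [map_sum]
  refine Submodule.sum_mem _ fun σ hσ => ?_
  rw [map_smul, localSubst_basicFraction]
  exact Submodule.smul_mem _ _ (Submodule.subset_span ⟨_, rotateSet_mem_jkBases g hσ, rfl⟩)

theorem localSubst_mem_spaceNS {Qs : Finset (Fin n → ℝ)} {F : LocalField n}
    (hF : F ∈ spaceNS Qs) : localSubst g F ∈ spaceNS (rotateSet g Qs) := by
  induction hF using Submodule.span_induction with
  | mem F h =>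
    obtain ⟨κ, hκ, hnb, m, k, ψ, hψ, hk, rfl⟩ := h
    refine Submodule.subset_span ⟨rotateSet g κ, rotateSet_subset g hκ, fun σ hσ hle => ?_,
      fun Q => m ((g⁻¹).1.mulVec Q), k, polySubst g.1 ψ, ?_, ?_, ?_⟩
    · have h1 := rotateSet_mem_jkBases g⁻¹ hσ
      have h2 := rotateSet_subset g⁻¹ hle
      rw [rotateSet_inv] at h1 h2
      exact hnb _ h1 h2
    · rw [← one_mul k]
      exact hψ.aeval _ fun j => isHomogeneous_linForm fun i => g.1 i j
    · simp only [sum_rotateSet, inv_mulVec_mulVec, hk]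
    · rw [map_div₀, localSubst_polyToLocal, localSubst_linProd]
  | zero => rw [map_zero]; exact Submodule.zero_mem _
  | add F G _ _ hF hG => rw [map_add]; exact Submodule.add_mem _ hF hG
  | smul c F _ hF => rw [map_smul]; exact Submodule.smul_mem _ _ hF

theorem isDegreePart_localSubst {Qs : Finset (Fin n → ℝ)} {d : ℤ} {F G : LocalField n}
    (h : IsDegreePart Qs d F G) :
    IsDegreePart (rotateSet g Qs) d (localSubst g F) (localSubst g G) := by
  obtain ⟨f, m, rfl, hG⟩ := h
  refine ⟨seriesSubst g.1 f, fun Q => m ((g⁻¹).1.mulVec Q), ?_, ?_⟩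
  · rw [map_div₀, localSubst_algebraMap, localSubst_linProd]
  · simp only [sum_rotateSet, inv_mulVec_mulVec]
    refine hG.imp ?_ ?_
    · rintro ⟨k, hk, rfl⟩
      refine ⟨k, hk, ?_⟩
      rw [map_div₀, localSubst_algebraMap, localSubst_linProd, homogeneousComponent_seriesSubst]
    · rintro ⟨hk, rfl⟩
      exact ⟨hk, map_zero _⟩

theorem isProjectiveSet_rotateSet {Qs : Finset (Fin n → ℝ)} (h : IsProjectiveSet Qs) :
    IsProjectiveSet (rotateSet g Qs) := by
  classical
  obtain ⟨δ, hδ⟩ := h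
  refine ⟨g.1.mulVec δ, fun Q hQ => ?_⟩
  obtain ⟨Q, hQ', rfl⟩ := Finset.mem_image.1 hQ
  have ho := (Matrix.mem_orthogonalGroup_iff' (Fin n) ℝ).1 g.2
  rw [Matrix.dotProduct_mulVec, ← Matrix.mulVec_transpose, Matrix.mulVec_mulVec, ho,
    Matrix.one_mulVec]
  exact hδ Q hQ'

/-- The projection to `S` commutes with orthogonal substitutions. Outside its domain of definition,
which is preserved by the substitutions, both sides are zero. -/
theorem simplePart_localSubst {Qs : Finset (Fin n → ℝ)} (hproj : IsProjectiveSet Qs)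
    (F : LocalField n) :
    (simplePart (rotateSet g Qs) (localSubst g F) : LocalField n) =
      localSubst g (simplePart Qs F) := by
  by_cases hex : ∃ s : spaceS Qs, ∃ G, IsDegreePart Qs (-(n : ℤ)) F G ∧
      G - (s : LocalField n) ∈ spaceNS Qs
  · obtain ⟨s, G, hG, hs⟩ := hex
    rw [simplePart_eq hproj hG hs]
    have := simplePart_eq (isProjectiveSet_rotateSet g hproj)
      (s := ⟨localSubst g s, localSubst_mem_spaceS g s.2⟩) (isDegreePart_localSubst g hG)
      (by simpa using localSubst_mem_spaceNS g hs)
    rw [this]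
  · have hex' : ¬ ∃ s : spaceS (rotateSet g Qs), ∃ G,
        IsDegreePart (rotateSet g Qs) (-(n : ℤ)) (localSubst g F) G ∧
        G - (s : LocalField n) ∈ spaceNS (rotateSet g Qs) := by
      rintro ⟨s, G, hG, hs⟩
      have h1 := localSubst_mem_spaceS g⁻¹ s.2
      have h2 := isDegreePart_localSubst g⁻¹ hG
      have h3 := localSubst_mem_spaceNS g⁻¹ hs
      rw [rotateSet_inv] at h1 h2 h3
      rw [localSubst_inv] at h2
      rw [map_sub] at h3
      exact hex ⟨⟨_, h1⟩, _, h2, h3⟩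
    rw [simplePart, dif_neg hex', simplePart, dif_neg hex]
    simp

end Orthogonal

/-! ### Expansions and residues along an orbit -/

theorem affineValue_add {n : ℕ} (h : (Fin n → ℝ) × ℂ) (φ w : Fin n → ℂ) :
    affineValue h (φ + w) = MvPolynomial.eval w (linForm h.1) + affineValue h φ := by
  rw [eval_linForm, affineValue, affineValue, ← add_assoc, ← Finset.sum_add_distrib]
  congr 1
  exact Finset.sum_congr rfl fun j _ => by rw [Pi.add_apply]; ring

section Orthogonal

variable {n : ℕ} (g : Matrix.orthogonalGroup (Fin n) ℝ)

theorem orthogonal_smul_add (φ w : Fin n → ℂ) : g • (φ + w) = g • φ + g • w :=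
  Matrix.mulVec_add _ _ _

/-- On values, `polySubst g` is composition with `g⁻¹`. -/
theorem eval_smul_polySubst (w : Fin n → ℂ) (p : MvPolynomial (Fin n) ℂ) :
    MvPolynomial.eval (g • w) (polySubst g.1 p) = MvPolynomial.eval w p := by
  have hw : (fun j => MvPolynomial.eval (g • w) (linForm fun i => g.1 i j)) = w := by
    have ho := (Matrix.mem_orthogonalGroup_iff' (Fin n) ℝ).1 g.2
    have : (g.1.transpose.map Complex.ofRealHom).mulVec
        ((g.1.map Complex.ofRealHom).mulVec w) = w := by
      rw [Matrix.mulVec_mulVec, ← Matrix.map_mul, ho]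
      simp
    conv_rhs => rw [← this]
    ext j
    rw [eval_linForm]
    rfl
  conv_rhs => rw [← hw]
  induction p using MvPolynomial.induction_on with
  | C a => simp [polySubst]
  | add p q hp hq => rw [map_add, map_add, map_add, hp, hq]
  | mul_X p j hp =>
    rw [map_mul, map_mul, map_mul, hp, MvPolynomial.eval_X, polySubst, MvPolynomial.aeval_X]

end Orthogonal

namespace FactorizedFraction

variable {n : ℕ} (Z : FactorizedFraction n)

/-- The numerator of the expansion at `φ`, as a polynomial in the local coordinates. -/
def localNum (φ : Fin n → ℂ) : MvPolynomial (Fin n) ℂ :=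
  MvPolynomial.bind₁ (fun j => MvPolynomial.X j + MvPolynomial.C (φ j)) Z.num

/-- The denominator of the expansion at `φ`, as a polynomial in the local coordinates. -/
def localDen (φ : Fin n → ℂ) : MvPolynomial (Fin n) ℂ :=
  ∏ h ∈ Z.factors, (linForm h.1 + MvPolynomial.C (affineValue h φ)) ^ Z.mult h

theorem expand_eq (φ : Fin n → ℂ) :
    Z.expand φ = polyToLocal (Z.localNum φ) / polyToLocal (Z.localDen φ) := by
  simp only [expand, localNum, localDen, polyToLocal_eq, map_prod, map_pow]

theorem eval_localNum (φ w : Fin n → ℂ) :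
    MvPolynomial.eval w (Z.localNum φ) = MvPolynomial.eval (φ + w) Z.num := by
  rw [localNum, ← MvPolynomial.coe_aeval_eq_eval, RingHom.coe_coe, MvPolynomial.aeval_bind₁,
    ← MvPolynomial.coe_aeval_eq_eval, RingHom.coe_coe]
  congr 2
  ext j
  simp [add_comm]

theorem eval_localDen (φ w : Fin n → ℂ) :
    MvPolynomial.eval w (Z.localDen φ) = ∏ h ∈ Z.factors, affineValue h (φ + w) ^ Z.mult h := by
  simp [localDen, affineValue_add]

theorem localDen_ne_zero (φ : Fin n → ℂ) : Z.localDen φ ≠ 0 := by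
  refine Finset.prod_ne_zero_iff.2 fun h hh => pow_ne_zero _ fun h0 => ?_
  have h1 := congrArg (MvPolynomial.eval 0) h0
  simp only [map_add, eval_linForm, MvPolynomial.eval_C] at h1
  have hc : affineValue h φ = 0 := by simpa using h1
  rw [hc, map_zero, add_zero] at h0
  exact linForm_ne_zero (Z.vec_ne_zero h hh) h0

theorem isRegularAt_of_eval_localDen_ne_zero {φ w : Fin n → ℂ}
    (h : MvPolynomial.eval w (Z.localDen φ) ≠ 0) : Z.IsRegularAt (φ + w) := by
  intro k hk h0
  rw [eval_localDen] at h
  refine h (Finset.prod_eq_zero hk ?_)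
  rw [h0, zero_pow (Z.mult_pos k hk).ne']

/-- The expansions of a `W`-invariant function at `φ` and at `g φ` correspond under the
substitution `x ↦ g⁻¹ x`. -/
theorem expand_smul {W : Subgroup (Matrix.orthogonalGroup (Fin n) ℝ)} (hsymm : Z.IsSymmetric W)
    {g : Matrix.orthogonalGroup (Fin n) ℝ} (hg : g ∈ W) (φ : Fin n → ℂ) :
    Z.expand (g • φ) = localSubst g (Z.expand φ) := by
  have hne : ∀ ψ, polyToLocal (Z.localDen ψ) ≠ 0 := fun ψ => by
    rw [polyToLocal_eq]
    exact (map_ne_zero_iff _ (polyToLocalHom_injective n)).2 (Z.localDen_ne_zero ψ)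
  have hne' : polyToLocal (polySubst g.1 (Z.localDen φ)) ≠ 0 := by
    rw [← localSubst_polyToLocal]
    exact (map_ne_zero_iff _ (localSubst g).injective).2 (hne φ)
  have hsub0 : polySubst g.1 (Z.localDen φ) ≠ 0 := by
    intro h0
    rw [h0, polyToLocal_eq, map_zero] at hne'
    exact hne' rfl
  have hpoly : Z.localNum (g • φ) * polySubst g.1 (Z.localDen φ) =
      polySubst g.1 (Z.localNum φ) * Z.localDen (g • φ) := by
    -- the two sides agree wherever both denominators are nonzero
    apply mul_left_cancel₀ (mul_ne_zero hsub0 (Z.localDen_ne_zero (g • φ)))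
    refine MvPolynomial.funext fun x => ?_
    obtain ⟨w, rfl⟩ : ∃ w, x = g • w := ⟨g⁻¹ • x, (smul_inv_smul g x).symm⟩
    simp only [map_mul, eval_smul_polySubst]
    by_cases h1 : MvPolynomial.eval w (Z.localDen φ) = 0
    · simp [h1]
    by_cases h2 : MvPolynomial.eval (g • w) (Z.localDen (g • φ)) = 0
    · simp [h2]
    have r1 := Z.isRegularAt_of_eval_localDen_ne_zero h1
    have r2 := Z.isRegularAt_of_eval_localDen_ne_zero h2
    rw [← orthogonal_smul_add] at r2
    have := hsymm g hg _ r1 r2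
    rw [eval, eval, orthogonal_smul_add, ← eval_localNum, ← eval_localNum, ← eval_localDen,
      ← eval_localDen, div_eq_div_iff h2 h1] at this
    rw [this]
  rw [expand_eq, expand_eq, map_div₀, localSubst_polyToLocal, localSubst_polyToLocal,
    div_eq_div_iff (hne _) hne']
  simp only [polyToLocal_eq, ← map_mul]
  rw [hpoly]

theorem isVertex_smul {W : Subgroup (Matrix.orthogonalGroup (Fin n) ℝ)} (hcompat : Z.IsCompatible W)
    {g : Matrix.orthogonalGroup (Fin n) ℝ} (hg : g ∈ W) {φ : Fin n → ℂ} (hφ : Z.IsVertex φ) :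
    Z.IsVertex (g • φ) := by
  rw [IsVertex, hcompat g hg φ hφ]
  obtain ⟨σ, hσ⟩ := hφ
  exact ⟨_, rotateSet_mem_jkBases g hσ⟩

/-- A vertex is determined by the set of hyperplanes that contain it. -/
theorem finite_isVertex : {φ : Fin n → ℂ | Z.IsVertex φ}.Finite := by
  classical
  refine Set.Finite.of_finite_image (f := fun φ => Z.factors.filter fun h => affineValue h φ = 0)
    (Z.factors.powerset.finite_toSet.subset ?_) ?_
  · rintro _ ⟨φ, -, rfl⟩
    exact Finset.mem_coe.2 (Finset.mem_powerset.2 (Finset.filter_subset _ _))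
  intro φ hφ φ' _ heq
  obtain ⟨σ, hσ⟩ := hφ
  have hsub := Finset.mem_powerset.1 (Finset.mem_filter.1 hσ).1
  have hsp := (Finset.mem_filter.1 hσ).2.2
  have horth : ∀ Q ∈ σ, ∑ j, (Q j : ℂ) * (φ j - φ' j) = 0 := by
    intro Q hQ
    obtain ⟨h, hh, rfl⟩ := Finset.mem_image.1 (hsub hQ)
    have h1 : affineValue h φ = 0 := (Finset.mem_filter.1 hh).2
    have hh' : h ∈ Z.factors.filter fun h => affineValue h φ' = 0 := by
      rw [← show _ = Z.factors.filter fun h => affineValue h φ' = 0 from heq]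
      simpa using hh
    have h2 : affineValue h φ' = 0 := (Finset.mem_filter.1 hh').2
    simp only [affineValue] at h1 h2
    simp only [mul_sub, Finset.sum_sub_distrib]
    linear_combination h1 - h2
  have hker : ∀ Q : Fin n → ℝ, ∑ j, (Q j : ℂ) * (φ j - φ' j) = 0 := by
    intro Q
    have hQ : Q ∈ Submodule.span ℝ (σ : Set (Fin n → ℝ)) := hsp ▸ Submodule.mem_top
    induction hQ using Submodule.span_induction with
    | mem Q hQ => exact horth Q hQ
    | zero => simp
    | add P Q _ _ hP hQ =>
      simp only [Pi.add_apply, Complex.ofReal_add, add_mul, Finset.sum_add_distrib, hP, hQ,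
        add_zero]
    | smul r Q _ hQ =>
      simp only [Pi.smul_apply, smul_eq_mul, Complex.ofReal_mul, mul_assoc, ← Finset.mul_sum, hQ,
        mul_zero]
  ext j
  have := hker (Pi.single j 1)
  rw [Finset.sum_eq_single j (fun i _ h => by simp [h]) (by simp)] at this
  simpa [sub_eq_zero] using this

theorem jkRes_eq_zero_of_not_isVertex {η : Fin n → ℝ} {φ : Fin n → ℂ} (hφ : ¬ Z.IsVertex φ) :
    Z.jkRes η φ = 0 := by
  have h0 : spaceS (Z.Qstar φ) = ⊥ := by
    rw [spaceS, Submodule.span_eq_bot]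
    rintro _ ⟨σ, hσ, -⟩
    exact absurd ⟨σ, hσ⟩ hφ
  have hs : simplePart (Z.Qstar φ) (Z.expand φ) = 0 := by
    apply Subtype.ext
    exact (Submodule.mem_bot ℂ).1 (h0.le (simplePart (Z.Qstar φ) (Z.expand φ)).2)
  rw [jkRes, localJKRes, hs, map_zero]

/-- The residue at `g φ` in terms of the expansion at `φ`. -/
theorem jkRes_smul {W : Subgroup (Matrix.orthogonalGroup (Fin n) ℝ)} (hsymm : Z.IsSymmetric W)
    (hcompat : Z.IsCompatible W) {g : Matrix.orthogonalGroup (Fin n) ℝ} (hg : g ∈ W)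
    {φ : Fin n → ℂ} (hφ : Z.IsVertex φ) (hproj : IsProjectiveSet (Z.Qstar φ))
    {η : Fin n → ℝ} (hη : IsGenericVector (Z.Qstar (g • φ)) η) {c : Finset (Fin n → ℝ) → ℂ}
    (hc : (simplePart (Z.Qstar φ) (Z.expand φ) : LocalField n) =
      ∑ σ ∈ jkBases (Z.Qstar φ), c σ • basicFraction σ) :
    Z.jkRes η (g • φ) = ∑ σ ∈ jkBases (Z.Qstar φ), c σ * jkWeight η (rotateSet g σ) := by
  rw [hcompat g hg φ hφ] at hη
  rw [jkRes, hcompat g hg φ hφ, Z.expand_smul hsymm hg, localJKRes,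
    jkFunctional_apply (isProjectiveSet_rotateSet g hproj) hη
      (c := fun τ => c (rotateSet g⁻¹ τ)), sum_jkBases_rotateSet]
  · simp only [rotateSet_inv]
  · rw [simplePart_localSubst g hproj, hc, map_sum, sum_jkBases_rotateSet]
    simp only [rotateSet_inv, map_smul, localSubst_basicFraction]

end FactorizedFraction

theorem sum_jkWeight_rotateSet {n : ℕ} (W : Subgroup (Matrix.orthogonalGroup (Fin n) ℝ))
    [Fintype W] {Qs σ : Finset (Fin n → ℝ)} (hσ : σ ∈ jkBases Qs) (η : Fin n → ℝ) :
    ∑ g : W, jkWeight η (rotateSet g.1 σ) = (coneCount W σ η : ℂ) / (absDet σ : ℂ) := by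
  classical
  rw [coneCount, Nat.cast_sum, Finset.sum_div]
  refine Finset.sum_congr rfl fun g _ => ?_
  rw [jkWeight, absDet_rotateSet g.1 hσ]
  split_ifs with h <;> simp [h]

/-- Summation of a function over an orbit, by the orbit–stabilizer theorem. -/
theorem sum_smul_eq_card_stabilizer_mul {G X R : Type*} [Group G] [Fintype G] [MulAction G X]
    [Semiring R] (x : X) (O : Finset X) (hO : ∀ y, y ∈ O ↔ y ∈ MulAction.orbit G x) (f : X → R) :
    ∑ g : G, f (g • x) = (Nat.card (MulAction.stabilizer G x) : R) * ∑ y ∈ O, f y := by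
  classical
  rw [← Finset.sum_fiberwise_of_maps_to (s := Finset.univ) (t := O) (g := fun g : G => g • x)
    fun g _ => (hO _).2 ⟨g, rfl⟩, Finset.mul_sum]
  refine Finset.sum_congr rfl fun y hy => ?_
  obtain ⟨g₀, rfl⟩ := (hO y).1 hy
  have hcard : (Finset.univ.filter fun g : G => g • x = g₀ • x).card =
      Nat.card (MulAction.stabilizer G x) := by
    rw [Nat.card_eq_fintype_card, ← Finset.card_univ]
    refine Finset.card_bij' (fun g hg => ⟨g₀⁻¹ * g, ?_⟩) (fun s _ => g₀ * s.1) ?_ ?_ ?_ ?_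
    · rw [MulAction.mem_stabilizer_iff, mul_smul, (Finset.mem_filter.1 hg).2, inv_smul_smul]
    · simp
    · intro s _
      simp [mul_smul, MulAction.mem_stabilizer_iff.1 s.2]
    · simp
    · simp
  rw [Finset.sum_congr rfl fun g hg => congrArg f (Finset.mem_filter.1 hg).2, Finset.sum_const,
    hcard, nsmul_eq_mul]

end

theorem mainTheorem3 {n : ℕ} (W : Subgroup (Matrix.orthogonalGroup (Fin n) ℝ)) [Fintype W]
    (Z : FactorizedFraction n) (hsymm : Z.IsSymmetric W) (hcompat : Z.IsCompatible W)
    (hproj : ∀ φ : Fin n → ℂ, Z.IsVertex φ → IsProjectiveSet (Z.Qstar φ))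
    (η : Fin n → ℝ) (hη : ∀ φ : Fin n → ℂ, Z.IsVertex φ → IsGenericVector (Z.Qstar φ) η)
    -- a representative of each orbit
    (rep : MulAction.orbitRel.Quotient W (Fin n → ℂ) → (Fin n → ℂ))
    (hrep : ∀ o, rep o ∈ o.orbit)
    -- coefficients of the image of `𝒵` in `S` at each representative
    (c : (Fin n → ℂ) → Finset (Fin n → ℝ) → ℂ)
    (hc : ∀ o, (simplePart (Z.Qstar (rep o)) (Z.expand (rep o)) : LocalField n) =
      ∑ σ ∈ jkBases (Z.Qstar (rep o)), c (rep o) σ • basicFraction σ) :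
    {φ : Fin n → ℂ | Z.IsVertex φ}.Finite ∧
    (∀ φ : Fin n → ℂ, Z.jkRes η φ ≠ 0 → Z.IsVertex φ) ∧
    Z.totalJKRes η =
      ∑ᶠ o : MulAction.orbitRel.Quotient W (Fin n → ℂ),
        (1 / (Nat.card (MulAction.stabilizer W (rep o)) : ℂ)) *
          ∑ σ ∈ jkBases (Z.Qstar (rep o)),
            (coneCount W σ η : ℂ) * c (rep o) σ / (absDet σ : ℂ) := by
  classical
  have hfin := Z.finite_isVertex
  have hnz : ∀ φ : Fin n → ℂ, Z.jkRes η φ ≠ 0 → Z.IsVertex φ := fun φ h =>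
    by_contra fun hφ => h (Z.jkRes_eq_zero_of_not_isVertex hφ)
  refine ⟨hfin, hnz, ?_⟩
  let mk : (Fin n → ℂ) → MulAction.orbitRel.Quotient W (Fin n → ℂ) := Quotient.mk''
  have hmk : ∀ φ o, mk φ = o ↔ φ ∈ MulAction.orbit W (rep o) := by
    intro φ o
    have h1 : mk (rep o) = o := MulAction.orbitRel.Quotient.mem_orbit.1 (hrep o)
    conv_lhs => rw [← h1]
    exact Quotient.eq''
  have hsmul : ∀ (g : W) {φ : Fin n → ℂ}, Z.IsVertex φ → Z.IsVertex (g • φ) := fun g φ hφ =>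
    Z.isVertex_smul hcompat g.2 hφ
  set V := hfin.toFinset with hV
  have hmemV : ∀ φ, φ ∈ V ↔ Z.IsVertex φ := fun φ => by simp [hV]
  have hleft : Z.totalJKRes η = ∑ φ ∈ V, Z.jkRes η φ :=
    finsum_eq_sum_of_support_subset _ fun φ hφ => Finset.mem_coe.2 ((hmemV φ).2 (hnz φ hφ))
  rw [hleft, finsum_eq_sum_of_support_subset (s := V.image mk),
    ← Finset.sum_fiberwise_of_maps_to (s := V) (t := V.image mk) (g := mk)
      fun φ hφ => Finset.mem_image_of_mem mk hφ]
  · refine Finset.sum_congr rfl fun o ho => ?_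
    have hvert : Z.IsVertex (rep o) := by
      obtain ⟨φ, hφ, hφo⟩ := Finset.mem_image.1 ho
      obtain ⟨g, rfl⟩ := (hmk φ o).1 hφo
      have := hsmul g⁻¹ ((hmemV _).1 hφ)
      rwa [inv_smul_smul] at this
    have horbit := sum_smul_eq_card_stabilizer_mul (G := W) (rep o) (V.filter fun φ => mk φ = o)
      (fun y => by
        rw [Finset.mem_filter, hmk, and_iff_right_iff_imp]
        rintro ⟨g, rfl⟩
        exact (hmemV _).2 (hsmul g hvert)) (Z.jkRes η)
    have hstab : (Nat.card (MulAction.stabilizer W (rep o)) : ℂ) ≠ 0 :=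
      Nat.cast_ne_zero.2 Nat.card_pos.ne'
    rw [one_div, eq_inv_mul_iff_mul_eq₀ hstab, ← horbit]
    have hres : ∀ g : W, Z.jkRes η (g • rep o) =
        ∑ σ ∈ jkBases (Z.Qstar (rep o)), c (rep o) σ * jkWeight η (rotateSet g.1 σ) := fun g =>
      Z.jkRes_smul hsymm hcompat g.2 hvert (hproj _ hvert) (hη _ (hsmul g hvert)) (hc o)
    rw [Finset.sum_congr rfl fun g _ => hres g, Finset.sum_comm]
    refine Finset.sum_congr rfl fun σ hσ => ?_
    rw [← Finset.mul_sum, sum_jkWeight_rotateSet W hσ]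
    ring
  · intro o ho
    refine Finset.mem_coe.2 (Finset.mem_image.2 ⟨rep o, (hmemV _).2 ?_, ?_⟩)
    · by_contra hvert
      apply ho
      beta_reduce
      rw [Finset.not_nonempty_iff_eq_empty.1 hvert, Finset.sum_empty, mul_zero]
    · exact MulAction.orbitRel.Quotient.mem_orbit.1 (hrep o)
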